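/- Let $\widehat{\mathbb C}=\mathbb C\cup\{\infty\}$, and for $\alpha\subseteq\widehat{\mathbb C}$ let $\mathcal A_\alpha$ be the group of all Möbius transformations $g$ with $g(\alpha)=\alpha$. For $n\ge 2$ let $G_n=\langle z\mapsto e^{2\pi i/n}z,\ z\mapsto 1/z\rangle$, which is isomorphic to the dihedral group $D_n$ of order $2n$ (to the Klein four-group $K_4$ if $n=2$). Its orbits on $\widehat{\mathbb C}$ are $V=\{0,\infty\}$, $A_n=\{e^{2\pi i j/n}:j\in\mathbb Z\}$, $B_n=\{e^{2\pi i(2j+1)/(2n)}:j\in\mathbb Z\}$, and $C_n(z)=\{ze^{2\pi i j/n}:j\in\mathbb Z\}\cup\{z^{-1}e^{2\pi i j/n}:j\in\mathbb Z\}$ for $z\in\mathbb C\setminus\{0\}$ not of the form $e^{2\pi i l/(2n)}$, $l\in\mathbb Z$. Let $\alpha$ be a finite union of orbits of $G_n$. If $n\ge3$, its dihedral-$n$ component index is $(\nu,\epsilon,k)\in\{0,1\}\times\{0,1,2\}\times\mathbb N$, where $\nu,\epsilon,k$ are the numbers of orbits contained in $\alpha$ that are equal to $V$, equal to $A_n$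 or $B_n$, and of the form $C_n(z)$, respectively. If $n=2$, its dihedral-$2$ component index is $(\nu,k)\in\{0,1,2,3\}\times\mathbb N$, where $\nu$ is the number of orbits among $V,A_2,B_2$, and $k$ the number of orbits of the form $C_2(z)$, contained in $\alpha$. (Here $0\in\mathbb N$.) **Theorem.** 1. Let $n\ge3$ and $(\nu,\epsilon,k)\in\{0,1\}\times\{0,1,2\}\times\mathbb N$. There is a finite union $\alpha$ of orbits of $G_n$ with component index $(\nu,\epsilon,k)$ and $\mathcal A_\alpha\simeq D_n$ if and only if $k\ge1$, or $(\nu,\epsilon,k)=(0,1,0)$, or $(\nu,\epsilon,k)=(1,1,0)$ and $n\ne4$. For every such $\alpha$ one has $\mathcal A_\alpha=G_n$ and $|\alpha|=2\nu+n(\epsilon+2k)$. 2. Let $(\nu,k)\in\{0,1,2,3\}\times\mathbb N$. There is a finite union $\alpha$ of orbits of $G_2$ with component index $(\nu,k)$ and $\mathcal A_\alpha\simeq K_4$ if and only if $k\ge1$. For every such $\alpha$ one has $\mathcal A_\alpha=G_2$ and $|\alpha|=2\nu+4k$. 3. The cardinalities of all finite sets $\alpha\subseteq\widehat{\mathbb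 C}$ with dihedral stabilizer are $$\{|\alpha|<\infty : \mathcal A_\alpha\simeq D_n\}=\{x+nk : x\in\{0,2\},\ k\ge1\}\qquad(n\ge3,\ n\ne4),$$ $$\{|\alpha|<\infty : \mathcal A_\alpha\simeq D_4\}=\{x+4k : x\in\{0,2\},\ k\ge2\}\cup\{4\},$$ $$\{|\alpha|<\infty : \mathcal A_\alpha\simeq K_4\}=\{2k : k\ge2\}.$$ 4. For $k\ge1$ and $n\ge2$, the set $\alpha=\bigcup_{l=1}^{k}C_n\bigl(e^{2\pi i l/(8k^2n)}\bigr)$ is a finite union of orbits of $G_n$ with component index $(0,0,k)$ and $\mathcal A_\alpha\simeq D_n$ if $n\ge3$, and with component index $(0,k)$ and $\mathcal A_\alpha\simeq K_4$ if $n=2$. -/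

import Mathlib

open scoped Pointwise

noncomputable section

/-- The group of Möbius transformations of the extended complex plane `ℂ ∪ {∞}`, as a group of
permutations: all maps `z ↦ (a z + b) / (c z + d)` with `a d - b c ≠ 0`. -/
def moebiusGroup : Subgroup (Equiv.Perm (OnePoint ℂ)) :=
  (MulAction.toPermHom (GL (Fin 2) ℂ) (OnePoint ℂ)).range

/-- The stabilizer of a set `α` of points of the extended complex plane: the group of all Möbius
transformations `g` with `g(α) = α`. -/
def moebiusStabilizer (α : Set (OnePoint ℂ)) : Subgroup (Equiv.Perm (OnePoint ℂ)) :=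
  moebiusGroup ⊓ MulAction.stabilizer (Equiv.Perm (OnePoint ℂ)) α

/-- The point `exp (2 π i t)` of the unit circle. -/
def circlePoint (t : ℝ) : ℂ := Complex.exp (2 * Real.pi * Complex.I * t)

lemma circlePoint_ne_zero (t : ℝ) : circlePoint t ≠ 0 := Complex.exp_ne_zero _

/-- The rotation `z ↦ exp (2 π i / n) z` (fixing `∞`). -/
def rotationMap (n : ℕ) : Equiv.Perm (OnePoint ℂ) :=
  MulAction.toPermHom (GL (Fin 2) ℂ) (OnePoint ℂ)
    (Matrix.GeneralLinearGroup.mkOfDetNeZero !![circlePoint (1 / n), 0; 0, 1]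
      (by simpa using circlePoint_ne_zero _))

/-- The inversion `z ↦ 1 / z` (exchanging `0` and `∞`). -/
def inversionMap : Equiv.Perm (OnePoint ℂ) :=
  MulAction.toPermHom (GL (Fin 2) ℂ) (OnePoint ℂ)
    (Matrix.GeneralLinearGroup.mkOfDetNeZero !![0, 1; 1, 0] (by simp))

/-- The dihedral group `⟨z ↦ exp (2 π i / n) z, z ↦ 1 / z⟩` of Möbius transformations. -/
def stdDihedral (n : ℕ) : Subgroup (Equiv.Perm (OnePoint ℂ)) :=
  Subgroup.closure {rotationMap n, inversionMap}

/-- `V = {0, ∞}`. -/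
def orbitV : Set (OnePoint ℂ) := {((0 : ℂ) : OnePoint ℂ), OnePoint.infty}

/-- `A_n = {exp (2 π i j / n) : j ∈ ℤ}`. -/
def orbitA (n : ℕ) : Set (OnePoint ℂ) :=
  {p | ∃ j : ℤ, p = ((circlePoint (j / n) : ℂ) : OnePoint ℂ)}

/-- `B_n = {exp (2 π i (2 j + 1) / (2 n)) : j ∈ ℤ}`. -/
def orbitB (n : ℕ) : Set (OnePoint ℂ) :=
  {p | ∃ j : ℤ, p = ((circlePoint ((2 * j + 1) / (2 * n)) : ℂ) : OnePoint ℂ)}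

/-- `C_n(z) = {z exp (2 π i j / n) : j ∈ ℤ} ∪ {z⁻¹ exp (2 π i j / n) : j ∈ ℤ}`. -/
def orbitC (n : ℕ) (z : ℂ) : Set (OnePoint ℂ) :=
  {p | ∃ j : ℤ, p = ((z * circlePoint (j / n) : ℂ) : OnePoint ℂ)} ∪
    {p | ∃ j : ℤ, p = ((z⁻¹ * circlePoint (j / n) : ℂ) : OnePoint ℂ)}

/-- The sets of the form `C_n(z)` with `z ≠ 0` and `z ≠ exp (2 π i l / (2 n))` for all `l ∈ ℤ`. -/
def typeC (n : ℕ) : Set (Set (OnePoint ℂ)) :=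
  {O | ∃ z : ℂ, z ≠ 0 ∧ (∀ l : ℤ, z ≠ circlePoint (l / (2 * n))) ∧ O = orbitC n z}

/-- `α` is a union of finitely many orbits of the group `stdDihedral n`. -/
def IsFiniteOrbitUnion (n : ℕ) (α : Set (OnePoint ℂ)) : Prop :=
  ∃ F : Set (OnePoint ℂ), F.Finite ∧ α = ⋃ p ∈ F, MulAction.orbit (stdDihedral n) p

/-- The dihedral-`n` component index `(ν, ε, k)` for `n ≥ 3`: the numbers of orbits of type `V`,
of type `A_n` or `B_n`, and of type `C_n` that make up `α`. -/
def dihedralIndex (n : ℕ) (α : Set (OnePoint ℂ)) : ℕ × ℕ × ℕ :=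
  (Set.ncard {O : Set (OnePoint ℂ) | O = orbitV ∧ O ⊆ α},
   Set.ncard {O : Set (OnePoint ℂ) | (O = orbitA n ∨ O = orbitB n) ∧ O ⊆ α},
   Set.ncard {O : Set (OnePoint ℂ) | O ∈ typeC n ∧ O ⊆ α})

/-- The dihedral-`2` component index `(ν, k)`: the number of orbits among `V`, `A_2`, `B_2` and
the number of orbits of type `C_2` that make up `α`. -/
def kleinIndex (α : Set (OnePoint ℂ)) : ℕ × ℕ :=
  (Set.ncard {O : Set (OnePoint ℂ) | (O = orbitV ∨ O = orbitA 2 ∨ O = orbitB 2) ∧ O ⊆ α},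
   Set.ncard {O : Set (OnePoint ℂ) | O ∈ typeC 2 ∧ O ⊆ α})

/-- `α` is a finite union of orbits of the dihedral group of order `2 n`, it has component index
`idx`, and its stabilizer is isomorphic to `D_n` (used for `n ≥ 3`). -/
def RealizesDihedral (n : ℕ) (idx : ℕ × ℕ × ℕ) (α : Set (OnePoint ℂ)) : Prop :=
  IsFiniteOrbitUnion n α ∧ dihedralIndex n α = idx ∧
    Nonempty (moebiusStabilizer α ≃* DihedralGroup n)

/-- `α` is a finite union of orbits of `⟨z ↦ -z, z ↦ 1 / z⟩`, it has component index `idx`, and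
its stabilizer is a Klein four-group. -/
def RealizesKlein (idx : ℕ × ℕ) (α : Set (OnePoint ℂ)) : Prop :=
  IsFiniteOrbitUnion 2 α ∧ kleinIndex α = idx ∧ IsKleinFour (moebiusStabilizer α)

/-- The set `⋃_{l = 1}^k C_n(exp (2 π i l / (8 k² n)))`. -/
def explicitSet (n k : ℕ) : Set (OnePoint ℂ) :=
  ⋃ l ∈ Finset.Icc 1 k, orbitC n (circlePoint (l / (8 * k ^ 2 * n)))

end

/-! The `n`-th power map turns `G_n` into the group `{w ↦ w, w ↦ 1/w}`: the orbits off `{0, ∞}` are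
the fibres over `1` and `-1` and the unions of the fibres over `w` and `w⁻¹`. This gives the
classification of orbits and the cardinality formula (`ncard_eq_of_invariant`). By counting, a
stabilizer containing `G_n` and isomorphic to `D_n` equals `G_n`, so the question is which invariant
sets have no further symmetry.

Existence rests on rigidity (`scaleMap_of_mem_moebiusStabilizer`). Let `α` consist of a set `S` on
the unit circle and a set `T`, with at least `|T| + 3` points in `S`. A symmetry `g` of `α` sends
three points of `S` into `S`, hence preserves the circle. Composing with the inversion if necessary,
`g` preserves the disc. If then `g(0) ≠ 0`, the commutator of `g` with a rotation is hyperbolic and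
has infinite order, which is impossible because a Möbius symmetry of a finite set with at least
three points has finite order. So `g` is a rotation, up to the inversion. A rotation `u` multiplies
the set of `n`-th powers of `S` by `u ^ n`; if these powers have non-zero sum, then `u ^ n = 1`
(`moebiusStabilizer_eq_of_sum_ne_zero`). The generic orbits are chosen with `n`-th powers close to
`1`, so that the sum is non-zero. The only realized index for which `S` is too small is that of the
triangular bipyramid (`n = 3`), settled by direct algebra.

Conversely, without generic orbits the remaining indices yield extra symmetries: all scalings, the
rotation of order `2n`, or a map moving `0` out of `{0, ∞}` (`special_conditions`). For the list of
all cardinalities, any dihedral group of Möbius transformations is conjugated to `G_n`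
(`exists_conj_eq_standard`). -/

open OnePoint

noncomputable section

/-! ### Möbius maps in coordinates, scalings and the inversion -/

/-- The Möbius transformation `z ↦ (a z + b) / (c z + d)`. -/
def moebiusMap (a b c d : ℂ) (h : a * d - b * c ≠ 0) : Equiv.Perm (OnePoint ℂ) :=
  MulAction.toPermHom (GL (Fin 2) ℂ) (OnePoint ℂ)
    (Matrix.GeneralLinearGroup.mkOfDetNeZero !![a, b; c, d] (by simpa [Matrix.det_fin_two] using h))

lemma moebiusMap_coe {a b c d : ℂ} (h : a * d - b * c ≠ 0) (z : ℂ) :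
    moebiusMap a b c d h z = if c * z + d = 0 then ∞ else (((a * z + b) / (c * z + d) : ℂ) : OnePoint ℂ) := by
  simp only [moebiusMap, MulAction.toPermHom_apply, MulAction.toPerm_apply]
  rw [OnePoint.smul_some_eq_ite]
  simp [Matrix.GeneralLinearGroup.mkOfDetNeZero]

lemma moebiusMap_infty {a b c d : ℂ} (h : a * d - b * c ≠ 0) :
    moebiusMap a b c d h ∞ = if c = 0 then ∞ else ((a / c : ℂ) : OnePoint ℂ) := by
  simp only [moebiusMap, MulAction.toPermHom_apply, MulAction.toPerm_apply]
  rw [OnePoint.smul_infty_eq_ite]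
  simp [Matrix.GeneralLinearGroup.mkOfDetNeZero]

lemma moebiusMap_mem {a b c d : ℂ} (h : a * d - b * c ≠ 0) :
    moebiusMap a b c d h ∈ moebiusGroup := ⟨_, rfl⟩

lemma toPermHom_eq_moebiusMap (M : GL (Fin 2) ℂ) :
    ∃ h, MulAction.toPermHom (GL (Fin 2) ℂ) (OnePoint ℂ) M =
      moebiusMap (M 0 0) (M 0 1) (M 1 0) (M 1 1) h := by
  have h := M.det_ne_zero
  rw [Matrix.det_fin_two] at h
  refine ⟨h, ?_⟩
  unfold moebiusMap
  congr 1
  ext i j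
  fin_cases i <;> fin_cases j <;> simp [Matrix.GeneralLinearGroup.mkOfDetNeZero]

lemma exists_eq_moebiusMap {f : Equiv.Perm (OnePoint ℂ)} (hf : f ∈ moebiusGroup) :
    ∃ a b c d h, f = moebiusMap a b c d h := by
  obtain ⟨M, rfl⟩ := hf
  obtain ⟨h, e⟩ := toPermHom_eq_moebiusMap M
  exact ⟨_, _, _, _, h, e⟩

/-- The scaling `z ↦ u z`, as a homomorphism. -/
def scaleMap : ℂˣ →* Equiv.Perm (OnePoint ℂ) where
  toFun u := moebiusMap u 0 0 1 (by simp)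
  map_one' := by
    ext p
    cases p <;> simp [moebiusMap_coe, moebiusMap_infty]
  map_mul' u v := by
    ext p
    cases p <;> simp [moebiusMap_coe, moebiusMap_infty, mul_assoc]

@[simp] lemma scaleMap_coe (u : ℂˣ) (z : ℂ) : scaleMap u z = ((u * z : ℂ) : OnePoint ℂ) := by
  simp [scaleMap, moebiusMap_coe]

@[simp] lemma scaleMap_infty (u : ℂˣ) : scaleMap u ∞ = ∞ := by
  simp [scaleMap, moebiusMap_infty]

lemma scaleMap_mem (u : ℂˣ) : scaleMap u ∈ moebiusGroup :=
  moebiusMap_mem (a := u) (b := 0) (c := 0) (d := 1) (by simp)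

lemma scaleMap_injective : Function.Injective scaleMap := by
  intro u v h
  have := congrArg (fun f : Equiv.Perm (OnePoint ℂ) => f ((1 : ℂ) : OnePoint ℂ)) h
  simp only [scaleMap_coe, mul_one, OnePoint.coe_eq_coe] at this
  exact Units.ext this

lemma inversionMap_eq : inversionMap = moebiusMap 0 1 1 0 (by simp) := rfl

lemma inversionMap_mem : inversionMap ∈ moebiusGroup := moebiusMap_mem (by simp)

lemma inversionMap_coe {z : ℂ} (hz : z ≠ 0) : inversionMap z = ((z⁻¹ : ℂ) : OnePoint ℂ) := by
  simp [inversionMap_eq, moebiusMap_coe, hz]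

@[simp] lemma inversionMap_zero : inversionMap ((0 : ℂ) : OnePoint ℂ) = ∞ := by
  simp [inversionMap_eq, moebiusMap_coe]

@[simp] lemma inversionMap_infty : inversionMap ∞ = ((0 : ℂ) : OnePoint ℂ) := by
  simp [inversionMap_eq, moebiusMap_infty]

lemma inversionMap_mul_self : inversionMap * inversionMap = 1 := by
  ext p
  induction p using OnePoint.rec with
  | infty => simp
  | coe z =>
    by_cases hz : z = 0
    · simp [hz]
    · simp [inversionMap_coe hz, inversionMap_coe (inv_ne_zero hz)]

lemma inversionMap_mul_scaleMap (u : ℂˣ) :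
    inversionMap * scaleMap u = scaleMap u⁻¹ * inversionMap := by
  ext p
  induction p using OnePoint.rec with
  | infty => simp only [Equiv.Perm.mul_apply, scaleMap_infty, inversionMap_infty, scaleMap_coe, mul_zero]
  | coe z =>
    by_cases hz : z = 0
    · simp only [hz, Equiv.Perm.mul_apply, scaleMap_infty, inversionMap_zero, scaleMap_coe, mul_zero]
    · have : (u : ℂ) * z ≠ 0 := mul_ne_zero u.ne_zero hz
      simp only [Equiv.Perm.mul_apply, scaleMap_coe, inversionMap_coe hz, inversionMap_coe this,
        mul_inv, Units.val_inv_eq_inv_val]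

/-! ### Points of the unit circle and roots of unity -/

/-- The unit `exp (2 π i t)`. -/
def circleUnit (t : ℝ) : ℂˣ := Units.mk0 (circlePoint t) (circlePoint_ne_zero t)

@[simp] lemma coe_circleUnit (t : ℝ) : (circleUnit t : ℂ) = circlePoint t := rfl

lemma rotationMap_eq (n : ℕ) : rotationMap n = scaleMap (circleUnit (1 / n)) := rfl

lemma circlePoint_add (s t : ℝ) : circlePoint (s + t) = circlePoint s * circlePoint t := by
  simp [circlePoint, ← Complex.exp_add, mul_add]

@[simp] lemma circlePoint_zero : circlePoint 0 = 1 := by simp [circlePoint]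

lemma circlePoint_nat_mul (n : ℕ) (t : ℝ) : circlePoint (n * t) = circlePoint t ^ n := by
  rw [circlePoint, circlePoint, ← Complex.exp_nat_mul]
  congr 1
  push_cast
  ring

lemma circlePoint_int_mul (n : ℤ) (t : ℝ) : circlePoint (n * t) = circlePoint t ^ n := by
  rw [circlePoint, circlePoint, ← Complex.exp_int_mul]
  congr 1
  push_cast
  ring

lemma circlePoint_neg (t : ℝ) : circlePoint (-t) = (circlePoint t)⁻¹ := by
  simp [circlePoint, ← Complex.exp_neg]

lemma circlePoint_eq_iff {s t : ℝ} : circlePoint s = circlePoint t ↔ ∃ j : ℤ, s = t + j := by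
  have hpi : (2 * Real.pi * Complex.I : ℂ) ≠ 0 := by simp [Real.pi_ne_zero, Complex.I_ne_zero]
  rw [circlePoint, circlePoint, Complex.exp_eq_exp_iff_exists_int]
  refine exists_congr fun j => ?_
  rw [show 2 * (Real.pi : ℂ) * Complex.I * t + j * (2 * Real.pi * Complex.I) =
    2 * Real.pi * Complex.I * (t + j) by ring, mul_right_inj' hpi]
  norm_cast

@[simp] lemma circlePoint_int (j : ℤ) : circlePoint j = 1 := by
  rw [← circlePoint_zero, circlePoint_eq_iff]
  exact ⟨j, by simp⟩

@[simp] lemma circlePoint_half : circlePoint (1 / 2) = -1 := by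
  rw [circlePoint, ← Complex.exp_pi_mul_I]
  congr 1
  push_cast
  ring

@[simp] lemma norm_circlePoint (t : ℝ) : ‖circlePoint t‖ = 1 := by
  rw [circlePoint, show 2 * (Real.pi : ℂ) * Complex.I * t = ((2 * Real.pi * t : ℝ) : ℂ) * Complex.I by
    push_cast; ring]
  exact Complex.norm_exp_ofReal_mul_I _

lemma circlePoint_re (t : ℝ) : (circlePoint t).re = Real.cos (2 * Real.pi * t) := by
  rw [circlePoint, show 2 * (Real.pi : ℂ) * Complex.I * t = ((2 * Real.pi * t : ℝ) : ℂ) * Complex.I by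
    push_cast; ring]
  exact Complex.exp_ofReal_mul_I_re _

lemma isPrimitiveRoot_circlePoint {n : ℕ} (hn : n ≠ 0) : IsPrimitiveRoot (circlePoint (1 / n)) n := by
  convert Complex.isPrimitiveRoot_exp n hn using 1
  rw [circlePoint]
  congr 1
  push_cast
  ring

lemma isPrimitiveRoot_circleUnit {n : ℕ} (hn : n ≠ 0) : IsPrimitiveRoot (circleUnit (1 / n)) n :=
  IsPrimitiveRoot.coe_units_iff.1 (isPrimitiveRoot_circlePoint hn)

/-- The roots of `z ^ n = w ^ n` are the products of `w` with the `n`-th roots of unity. -/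
lemma pow_eq_pow_iff_circlePoint {n : ℕ} (hn : n ≠ 0) {z w : ℂ} (hw : w ≠ 0) :
    z ^ n = w ^ n ↔ ∃ j : ℤ, z = w * circlePoint (j / n) := by
  have key (j : ℤ) : circlePoint (j / n) = circlePoint (1 / n) ^ j := by
    rw [← circlePoint_int_mul]
    congr 1
    ring
  constructor
  · intro h
    have h1 : (z / w) ^ n = 1 := by rw [div_pow, h, div_self (pow_ne_zero _ hw)]
    have : NeZero n := ⟨hn⟩
    obtain ⟨i, -, hi⟩ := (isPrimitiveRoot_circlePoint hn).eq_pow_of_pow_eq_one h1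
    refine ⟨i, ?_⟩
    rw [key, zpow_natCast, hi]
    field_simp
  · rintro ⟨j, rfl⟩
    rw [mul_pow, ← circlePoint_nat_mul, mul_div_cancel₀ _ (by exact_mod_cast hn), circlePoint_int,
      mul_one]

/-! ### The structure of the standard dihedral group -/

/-- The inversion conjugates each scaling to its inverse, so these maps are closed under products
and inverses. -/
lemma mem_stdDihedral_iff {n : ℕ} (hn : n ≠ 0) {f : Equiv.Perm (OnePoint ℂ)} :
    f ∈ stdDihedral n ↔ ∃ u : ℂˣ, u ^ n = 1 ∧ (f = scaleMap u ∨ f = scaleMap u * inversionMap) := by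
  constructor
  · intro hf
    induction hf using Subgroup.closure_induction with
    | mem x hx =>
      rcases hx with rfl | rfl
      · exact ⟨_, (isPrimitiveRoot_circleUnit hn).pow_eq_one, .inl (rotationMap_eq n)⟩
      · exact ⟨1, one_pow _, .inr (by simp)⟩
    | one => exact ⟨1, one_pow _, .inl (by simp)⟩
    | mul x y _ _ hx hy =>
      obtain ⟨u, hu, hx⟩ := hx
      obtain ⟨v, hv, hy⟩ := hy
      rcases hx with rfl | rfl <;> rcases hy with rfl | rfl
      · exact ⟨u * v, by simp [mul_pow, hu, hv], .inl (by simp)⟩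
      · exact ⟨u * v, by simp [mul_pow, hu, hv], .inr (by simp [mul_assoc])⟩
      · exact ⟨u * v⁻¹, by simp [mul_pow, hu, hv], .inr (by
          rw [mul_assoc, inversionMap_mul_scaleMap, map_mul, mul_assoc])⟩
      · exact ⟨u * v⁻¹, by simp [mul_pow, hu, hv], .inl (by
          rw [mul_assoc, ← mul_assoc inversionMap, inversionMap_mul_scaleMap, mul_assoc,
            inversionMap_mul_self, map_mul, mul_one])⟩
    | inv x _ hx =>
      obtain ⟨u, hu, hx⟩ := hx
      rcases hx with rfl | rfl
      · exact ⟨u⁻¹, by simp [hu], .inl (by simp)⟩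
      · exact ⟨u, hu, .inr (by
          rw [mul_inv_rev, inv_eq_of_mul_eq_one_left inversionMap_mul_self, ← map_inv,
            inversionMap_mul_scaleMap, inv_inv])⟩
  · rintro ⟨u, hu, hf⟩
    have h1 : scaleMap u ∈ stdDihedral n := by
      have : NeZero n := ⟨hn⟩
      obtain ⟨i, -, hi⟩ := (isPrimitiveRoot_circlePoint hn).eq_pow_of_pow_eq_one
        (ξ := (u : ℂ)) (by simpa using congrArg Units.val hu)
      have hi : circleUnit (1 / n) ^ i = u := Units.ext (by simpa using hi)
      rw [← hi, map_pow, ← rotationMap_eq]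
      exact Subgroup.pow_mem _ (Subgroup.subset_closure (by simp)) _
    rcases hf with rfl | rfl
    · exact h1
    · exact Subgroup.mul_mem _ h1 (Subgroup.subset_closure (by simp))

lemma inversionMap_mem_stdDihedral (n : ℕ) : inversionMap ∈ stdDihedral n :=
  Subgroup.subset_closure (by simp)

lemma stdDihedral_le_moebiusGroup (n : ℕ) : stdDihedral n ≤ moebiusGroup := by
  rw [stdDihedral, Subgroup.closure_le]
  rintro x (rfl | rfl)
  · rw [rotationMap_eq]
    exact scaleMap_mem _
  · exact inversionMap_mem

/-- The homomorphism `j ↦ r ^ j` on `ℤ / n` when `r ^ n = 1`. -/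
def zmodPow {G : Type*} [Group G] (n : ℕ) (r : G) (hr : r ^ n = 1) : ZMod n →+ Additive G :=
  ZMod.lift n ⟨AddMonoidHom.mk' (fun j => Additive.ofMul (r ^ j)) (fun i j => by
    rw [zpow_add, ofMul_mul]), by
    change Additive.ofMul (r ^ ((n : ℕ) : ℤ)) = 0
    rw [zpow_natCast, hr, ofMul_one]⟩

lemma zmodPow_intCast {G : Type*} [Group G] (n : ℕ) (r : G) (hr : r ^ n = 1) (j : ℤ) :
    (zmodPow n r hr (j : ZMod n)).toMul = r ^ j := by
  simp [zmodPow]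

/-- The presentation of the dihedral group: a rotation of order dividing `n` and a reflection
define a homomorphism. -/
def dihedralLift {G : Type*} [Group G] (n : ℕ) (r s : G) (hr : r ^ n = 1) (hs : s * s = 1)
    (hsr : s * r = r⁻¹ * s) : DihedralGroup n →* G where
  toFun
    | .r i => (zmodPow n r hr i).toMul
    | .sr i => s * (zmodPow n r hr i).toMul
  map_one' := by
    change (zmodPow n r hr 0).toMul = 1
    rw [map_zero, toMul_zero]
  map_mul' := by
    have hconj (j : ℤ) : s * r ^ j = r ^ (-j) * s := by
      have h0 : SemiconjBy s r r⁻¹ := hsr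
      have := (h0.zpow_right j).eq
      rwa [inv_zpow, ← zpow_neg] at this
    rintro (i | i) (j | j) <;> obtain ⟨i, rfl⟩ := ZMod.intCast_surjective i <;>
      obtain ⟨j, rfl⟩ := ZMod.intCast_surjective j
    · simp only [DihedralGroup.r_mul_r, ← Int.cast_add, zmodPow_intCast, zpow_add]
    · simp only [DihedralGroup.r_mul_sr, ← Int.cast_sub, zmodPow_intCast]
      rw [← mul_assoc, ← neg_neg i, ← hconj, mul_assoc, ← zpow_add]
      congr 2
      ring
    · simp only [DihedralGroup.sr_mul_r, ← Int.cast_add, zmodPow_intCast, zpow_add, mul_assoc]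
    · simp only [DihedralGroup.sr_mul_sr, ← Int.cast_sub, zmodPow_intCast]
      rw [hconj, mul_assoc, ← mul_assoc s s, hs, one_mul, ← zpow_add]
      congr 1
      ring

lemma dihedralLift_r {G : Type*} [Group G] (n : ℕ) (r s : G) (hr : r ^ n = 1) (hs : s * s = 1)
    (hsr : s * r = r⁻¹ * s) (j : ℤ) :
    dihedralLift n r s hr hs hsr (.r (j : ZMod n)) = r ^ j :=
  zmodPow_intCast n r hr j

lemma dihedralLift_sr {G : Type*} [Group G] (n : ℕ) (r s : G) (hr : r ^ n = 1) (hs : s * s = 1)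
    (hsr : s * r = r⁻¹ * s) (j : ℤ) :
    dihedralLift n r s hr hs hsr (.sr (j : ZMod n)) = s * r ^ j :=
  congrArg (s * ·) (zmodPow_intCast n r hr j)

lemma scaleMap_mul_inversionMap_ne (u v : ℂˣ) : scaleMap u * inversionMap ≠ scaleMap v := by
  intro h
  have := congrArg (fun f : Equiv.Perm (OnePoint ℂ) => f ∞) h
  simp at this

lemma orderOf_rotationMap {n : ℕ} (hn : n ≠ 0) : orderOf (rotationMap n) = n := by
  rw [rotationMap_eq, orderOf_injective _ scaleMap_injective,
    ← (isPrimitiveRoot_circleUnit hn).eq_orderOf]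

/-- The dihedral relations hold for the two generators. The resulting homomorphism is injective
because the rotation has order exactly `n` and because the images of the reflections move `∞`, which
every scaling fixes. -/
lemma nonempty_stdDihedral_mulEquiv {n : ℕ} (hn : n ≠ 0) :
    Nonempty (stdDihedral n ≃* DihedralGroup n) := by
  have hr : rotationMap n ^ n = 1 := by
    simpa [orderOf_rotationMap hn] using pow_orderOf_eq_one (rotationMap n)
  have hsr : inversionMap * rotationMap n = (rotationMap n)⁻¹ * inversionMap := by
    rw [rotationMap_eq, inversionMap_mul_scaleMap, map_inv]
  set φ := dihedralLift n (rotationMap n) inversionMap hr inversionMap_mul_self hsr with hφ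
  have hinj : Function.Injective φ := by
    rw [injective_iff_map_eq_one]
    rintro (i | i) h <;> obtain ⟨i, rfl⟩ := ZMod.intCast_surjective i
    · rw [hφ, dihedralLift_r, ← orderOf_dvd_iff_zpow_eq_one, orderOf_rotationMap hn] at h
      rw [(ZMod.intCast_zmod_eq_zero_iff_dvd _ _).2 h, DihedralGroup.r_zero]
    · rw [hφ, dihedralLift_sr, rotationMap_eq, ← map_zpow, inversionMap_mul_scaleMap] at h
      exact absurd (h.trans (map_one _).symm) (scaleMap_mul_inversionMap_ne _ _)
  have hrange : φ.range = stdDihedral n := by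
    apply le_antisymm
    · rintro _ ⟨i | i, rfl⟩ <;> obtain ⟨i, rfl⟩ := ZMod.intCast_surjective i
      · rw [hφ, dihedralLift_r]
        exact Subgroup.zpow_mem _ (Subgroup.subset_closure (by simp)) _
      · rw [hφ, dihedralLift_sr]
        exact Subgroup.mul_mem _ (Subgroup.subset_closure (by simp))
          (Subgroup.zpow_mem _ (Subgroup.subset_closure (by simp)) _)
    · rw [stdDihedral, Subgroup.closure_le]
      rintro x (rfl | rfl)
      · exact ⟨.r ((1 : ℤ) : ZMod n), by rw [hφ, dihedralLift_r, zpow_one]⟩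
      · exact ⟨.sr ((0 : ℤ) : ZMod n), by rw [hφ, dihedralLift_sr, zpow_zero, mul_one]⟩
  exact ⟨((MonoidHom.ofInjective hinj).trans (MulEquiv.subgroupCongr hrange)).symm⟩

lemma card_stdDihedral {n : ℕ} (hn : n ≠ 0) : Nat.card (stdDihedral n) = 2 * n := by
  obtain ⟨e⟩ := nonempty_stdDihedral_mulEquiv hn
  rw [Nat.card_congr e.toEquiv, DihedralGroup.nat_card]

lemma finite_stdDihedral {n : ℕ} (hn : n ≠ 0) : Finite (stdDihedral n) :=
  Nat.finite_of_card_ne_zero (by rw [card_stdDihedral hn]; positivity)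

/-- Lets the case `n = 2` run through the same argument as `n ≥ 3`. -/
lemma isKleinFour_iff_nonempty_mulEquiv {G : Type*} [Group G] :
    IsKleinFour G ↔ Nonempty (G ≃* DihedralGroup 2) := by
  constructor
  · intro h
    exact IsKleinFour.nonempty_mulEquiv
  · rintro ⟨e⟩
    exact ⟨by rw [Nat.card_congr e.toEquiv, IsKleinFour.card_four],
      by rw [Monoid.exponent_eq_of_mulEquiv e, IsKleinFour.exponent_two]⟩

/-! ### Stabilizers and invariant sets -/

lemma mem_moebiusStabilizer {α : Set (OnePoint ℂ)} {f : Equiv.Perm (OnePoint ℂ)} :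
    f ∈ moebiusStabilizer α ↔ f ∈ moebiusGroup ∧ ∀ p, f p ∈ α ↔ p ∈ α := by
  rw [moebiusStabilizer, Subgroup.mem_inf, MulAction.mem_stabilizer_set]
  rfl

/-- An injective map of a finite set into itself is onto, so one inclusion is enough. -/
lemma mem_moebiusStabilizer_of_finite {α : Set (OnePoint ℂ)} (hα : α.Finite)
    {f : Equiv.Perm (OnePoint ℂ)} (hf : f ∈ moebiusGroup) (h : ∀ p ∈ α, f p ∈ α) :
    f ∈ moebiusStabilizer α := by
  rw [mem_moebiusStabilizer]
  refine ⟨hf, fun p => ⟨fun hp => ?_, h p⟩⟩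
  have hs : f '' α = α := Set.eq_of_subset_of_ncard_le (Set.image_subset_iff.2 h)
    (Set.ncard_image_of_injective _ f.injective).ge hα
  rw [← hs] at hp
  obtain ⟨q, hq, hqp⟩ := hp
  rwa [← f.injective hqp]

lemma stdDihedral_le_moebiusStabilizer {n : ℕ} (hn : n ≠ 0) {α : Set (OnePoint ℂ)}
    (h1 : ∀ u : ℂˣ, u ^ n = 1 → ∀ p ∈ α, scaleMap u p ∈ α) (h2 : ∀ p ∈ α, inversionMap p ∈ α) :
    stdDihedral n ≤ moebiusStabilizer α := by
  have key : ∀ f ∈ stdDihedral n, ∀ p ∈ α, f p ∈ α := by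
    intro f hf p hp
    obtain ⟨u, hu, rfl | rfl⟩ := (mem_stdDihedral_iff hn).1 hf
    · exact h1 u hu p hp
    · exact h1 u hu _ (h2 p hp)
  intro f hf
  refine mem_moebiusStabilizer.2 ⟨stdDihedral_le_moebiusGroup n hf, fun p => ⟨fun hp => ?_, key f hf p⟩⟩
  simpa using key _ (Subgroup.inv_mem _ hf) _ hp

section Invariant

variable {n : ℕ} {α : Set (OnePoint ℂ)}

lemma coe_mem_of_pow_eq (hn : n ≠ 0) (hα : stdDihedral n ≤ moebiusStabilizer α) {z w : ℂ}
    (hz : (z : OnePoint ℂ) ∈ α) (h : w ^ n = z ^ n) : (w : OnePoint ℂ) ∈ α := by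
  by_cases hz0 : z = 0
  · rw [hz0, zero_pow hn] at h
    rwa [pow_eq_zero_iff hn |>.1 h, ← hz0]
  · have hw0 : w ≠ 0 := by
      rintro rfl
      rw [zero_pow hn] at h
      exact hz0 (pow_eq_zero_iff hn |>.1 h.symm)
    have hu : scaleMap (Units.mk0 (w / z) (div_ne_zero hw0 hz0)) ∈ stdDihedral n := by
      refine (mem_stdDihedral_iff hn).2 ⟨_, ?_, .inl rfl⟩
      ext
      simp [div_pow, h, hz0]
    have := ((mem_moebiusStabilizer.1 (hα hu)).2 z).2 hz
    rwa [scaleMap_coe, Units.val_mk0, div_mul_cancel₀ _ hz0] at this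

lemma inversionMap_apply_mem (hα : stdDihedral n ≤ moebiusStabilizer α) {p : OnePoint ℂ} :
    inversionMap p ∈ α ↔ p ∈ α :=
  (mem_moebiusStabilizer.1 (hα (inversionMap_mem_stdDihedral n))).2 p

lemma zero_mem_iff_infty_mem (hα : stdDihedral n ≤ moebiusStabilizer α) :
    ((0 : ℂ) : OnePoint ℂ) ∈ α ↔ ∞ ∈ α := by
  rw [← inversionMap_infty, inversionMap_apply_mem hα]

end Invariant

/-! ### Orbits as fibres of the `n`-th power map -/

/-- The finite points `z` with `z ^ n = w`. -/
def powFiber (n : ℕ) (w : ℂ) : Set (OnePoint ℂ) := (fun z : ℂ => (z : OnePoint ℂ)) '' {z | z ^ n = w}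

lemma coe_mem_powFiber {n : ℕ} {w z : ℂ} : (z : OnePoint ℂ) ∈ powFiber n w ↔ z ^ n = w := by
  simp [powFiber]

@[simp] lemma infty_notMem_powFiber {n : ℕ} {w : ℂ} : ∞ ∉ powFiber n w := by
  simp [powFiber]

lemma circlePoint_odd_pow {n : ℕ} (hn : n ≠ 0) : circlePoint (1 / (2 * n)) ^ n = -1 := by
  rw [← circlePoint_nat_mul, ← circlePoint_half]
  congr 1
  have : (n : ℝ) ≠ 0 := by exact_mod_cast hn
  field_simp

lemma setOf_circlePoint_eq_powFiber {n : ℕ} (hn : n ≠ 0) {z : ℂ} (hz : z ≠ 0) :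
    {p : OnePoint ℂ | ∃ j : ℤ, p = ((z * circlePoint (j / n) : ℂ) : OnePoint ℂ)} =
      powFiber n (z ^ n) := by
  ext p
  cases p with
  | infty => simp
  | coe w =>
    rw [coe_mem_powFiber, pow_eq_pow_iff_circlePoint hn hz]
    simp

lemma orbitA_eq {n : ℕ} (hn : n ≠ 0) : orbitA n = powFiber n 1 := by
  simpa [orbitA] using setOf_circlePoint_eq_powFiber hn one_ne_zero

lemma orbitB_eq {n : ℕ} (hn : n ≠ 0) : orbitB n = powFiber n (-1) := by
  rw [← circlePoint_odd_pow hn, ← setOf_circlePoint_eq_powFiber hn (circlePoint_ne_zero _), orbitB]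
  have hn' : (n : ℝ) ≠ 0 := by exact_mod_cast hn
  congr! 7 with p j
  rw [← circlePoint_add]
  congr 1
  field_simp
  ring

lemma orbitC_eq {n : ℕ} (hn : n ≠ 0) {z : ℂ} (hz : z ≠ 0) :
    orbitC n z = powFiber n (z ^ n) ∪ powFiber n (z ^ n)⁻¹ := by
  rw [orbitC, setOf_circlePoint_eq_powFiber hn hz, setOf_circlePoint_eq_powFiber hn (inv_ne_zero hz),
    inv_pow]

lemma coe_mem_orbitA {n : ℕ} (hn : n ≠ 0) {z : ℂ} : (z : OnePoint ℂ) ∈ orbitA n ↔ z ^ n = 1 := by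
  rw [orbitA_eq hn, coe_mem_powFiber]

lemma coe_mem_orbitB {n : ℕ} (hn : n ≠ 0) {z : ℂ} : (z : OnePoint ℂ) ∈ orbitB n ↔ z ^ n = -1 := by
  rw [orbitB_eq hn, coe_mem_powFiber]

lemma coe_mem_orbitC {n : ℕ} (hn : n ≠ 0) {z w : ℂ} (hz : z ≠ 0) :
    (w : OnePoint ℂ) ∈ orbitC n z ↔ w ^ n = z ^ n ∨ w ^ n = (z ^ n)⁻¹ := by
  rw [orbitC_eq hn hz, Set.mem_union, coe_mem_powFiber, coe_mem_powFiber]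

lemma coe_mem_orbitV {z : ℂ} : (z : OnePoint ℂ) ∈ orbitV ↔ z = 0 := by
  simp [orbitV]

@[simp] lemma infty_mem_orbitV : ∞ ∈ orbitV := by simp [orbitV]

@[simp] lemma infty_notMem_orbitA {n : ℕ} : ∞ ∉ orbitA n := by simp [orbitA]

@[simp] lemma infty_notMem_orbitB {n : ℕ} : ∞ ∉ orbitB n := by simp [orbitB]

@[simp] lemma infty_notMem_orbitC {n : ℕ} {z : ℂ} : ∞ ∉ orbitC n z := by simp [orbitC]

/-- The excluded points are the `2n`-th roots of unity, and `z ^ (2n) = 1` means that `z ^ n` is `1`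
or `-1`. -/
lemma typeC_cond_iff {n : ℕ} (hn : n ≠ 0) (z : ℂ) :
    (∀ l : ℤ, z ≠ circlePoint (l / (2 * n))) ↔ z ^ n ≠ 1 ∧ z ^ n ≠ -1 := by
  have h := pow_eq_pow_iff_circlePoint (n := 2 * n) (by positivity) (z := z) one_ne_zero
  simp only [one_pow, one_mul] at h
  push_cast at h
  rw [← not_exists, ← not_or, not_iff_not, ← h, mul_comm, pow_mul, sq_eq_one_iff]

lemma mem_typeC_iff {n : ℕ} (hn : n ≠ 0) {O : Set (OnePoint ℂ)} :
    O ∈ typeC n ↔ ∃ z : ℂ, z ≠ 0 ∧ z ^ n ≠ 1 ∧ z ^ n ≠ -1 ∧ O = orbitC n z := by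
  simp only [typeC, Set.mem_ofPred_eq, typeC_cond_iff hn, and_assoc]

lemma ncard_powFiber {n : ℕ} (hn : n ≠ 0) {w : ℂ} (hw : w ≠ 0) : (powFiber n w).ncard = n := by
  rw [powFiber, Set.ncard_image_of_injective _ OnePoint.coe_injective]
  obtain ⟨z, hz⟩ := IsAlgClosed.exists_pow_nat_eq w (Nat.pos_of_ne_zero hn)
  have h := (isPrimitiveRoot_circlePoint hn).card_nthRoots w
  rw [if_pos ⟨z, hz⟩] at h
  have hnd := (isPrimitiveRoot_circlePoint hn).nthRoots_nodup (a := w) hw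
  classical
  rw [← Multiset.toFinset_card_of_nodup hnd, ← Set.ncard_coe_finset] at h
  refine Eq.trans ?_ h
  congr 1
  ext x
  simp [Polynomial.mem_nthRoots (Nat.pos_of_ne_zero hn)]

lemma finite_powFiber {n : ℕ} (hn : n ≠ 0) {w : ℂ} (hw : w ≠ 0) : (powFiber n w).Finite :=
  Set.finite_of_ncard_ne_zero (by rwa [ncard_powFiber hn hw])

lemma finite_orbitV : orbitV.Finite := by simp [orbitV]

lemma ncard_orbitV : orbitV.ncard = 2 := Set.ncard_pair (by simp)

lemma ncard_orbitA {n : ℕ} (hn : n ≠ 0) : (orbitA n).ncard = n := by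
  rw [orbitA_eq hn, ncard_powFiber hn one_ne_zero]

lemma ncard_orbitB {n : ℕ} (hn : n ≠ 0) : (orbitB n).ncard = n := by
  rw [orbitB_eq hn, ncard_powFiber hn (by simp)]

lemma finite_orbitC {n : ℕ} (hn : n ≠ 0) {z : ℂ} (hz : z ≠ 0) : (orbitC n z).Finite := by
  rw [orbitC_eq hn hz]
  exact (finite_powFiber hn (by positivity)).union (finite_powFiber hn (by positivity))

lemma ncard_orbitC {n : ℕ} (hn : n ≠ 0) {z : ℂ} (hz : z ≠ 0) (h1 : z ^ n ≠ 1) (h2 : z ^ n ≠ -1) :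
    (orbitC n z).ncard = 2 * n := by
  have hzn := pow_ne_zero n hz
  rw [orbitC_eq hn hz, Set.ncard_union_eq _ (finite_powFiber hn hzn)
    (finite_powFiber hn (inv_ne_zero hzn)), ncard_powFiber hn hzn, ncard_powFiber hn (inv_ne_zero hzn),
    two_mul]
  rw [Set.disjoint_left]
  rintro _ ⟨w, hw, rfl⟩ h
  rw [coe_mem_powFiber] at h
  rw [Set.mem_ofPred_eq, h] at hw
  -- The two fibres can only meet if `z ^ n` is its own inverse, that is `1` or `-1`.
  have : (z ^ n) ^ 2 = 1 := by
    rw [sq]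
    nth_rewrite 1 [← hw]
    exact inv_mul_cancel₀ hzn
  rcases sq_eq_one_iff.1 this with h | h
  · exact h1 h
  · exact h2 h

section Invariant

variable {n : ℕ} {α : Set (OnePoint ℂ)}

lemma powFiber_subset_iff (hn : n ≠ 0) (hα : stdDihedral n ≤ moebiusStabilizer α) {z : ℂ} :
    powFiber n (z ^ n) ⊆ α ↔ (z : OnePoint ℂ) ∈ α := by
  refine ⟨fun h => h (coe_mem_powFiber.2 rfl), ?_⟩
  rintro hz _ ⟨w, hw, rfl⟩
  exact coe_mem_of_pow_eq hn hα hz hw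

lemma orbitA_subset_iff (hn : n ≠ 0) (hα : stdDihedral n ≤ moebiusStabilizer α) {z : ℂ}
    (hz : z ^ n = 1) : orbitA n ⊆ α ↔ (z : OnePoint ℂ) ∈ α := by
  rw [orbitA_eq hn, ← hz, powFiber_subset_iff hn hα]

lemma orbitB_subset_iff (hn : n ≠ 0) (hα : stdDihedral n ≤ moebiusStabilizer α) {z : ℂ}
    (hz : z ^ n = -1) : orbitB n ⊆ α ↔ (z : OnePoint ℂ) ∈ α := by
  rw [orbitB_eq hn, ← hz, powFiber_subset_iff hn hα]

lemma orbitC_subset_iff (hn : n ≠ 0) (hα : stdDihedral n ≤ moebiusStabilizer α) {z : ℂ}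
    (hz : z ≠ 0) : orbitC n z ⊆ α ↔ (z : OnePoint ℂ) ∈ α := by
  refine ⟨fun h => h ((coe_mem_orbitC hn hz).2 (.inl rfl)), fun h => ?_⟩
  rw [orbitC_eq hn hz, Set.union_subset_iff, powFiber_subset_iff hn hα, ← inv_pow,
    powFiber_subset_iff hn hα, ← inversionMap_coe hz, inversionMap_apply_mem hα]
  exact ⟨h, h⟩

lemma orbitV_subset_iff_zero (hα : stdDihedral n ≤ moebiusStabilizer α) :
    orbitV ⊆ α ↔ ((0 : ℂ) : OnePoint ℂ) ∈ α := by
  rw [orbitV, Set.insert_subset_iff, Set.singleton_subset_iff, ← zero_mem_iff_infty_mem hα, and_self]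

lemma orbitV_subset_iff_infty (hα : stdDihedral n ≤ moebiusStabilizer α) :
    orbitV ⊆ α ↔ ∞ ∈ α := by
  rw [orbitV_subset_iff_zero hα, zero_mem_iff_infty_mem hα]

end Invariant

lemma orbitC_eq_orbitC_iff {n : ℕ} (hn : n ≠ 0) {z w : ℂ} (hz : z ≠ 0) (hw : w ≠ 0) :
    orbitC n w = orbitC n z ↔ w ^ n = z ^ n ∨ w ^ n = (z ^ n)⁻¹ := by
  constructor
  · intro h
    rw [← coe_mem_orbitC hn hz, ← h, coe_mem_orbitC hn hw]
    exact .inl rfl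
  · intro h
    rw [orbitC_eq hn hz, orbitC_eq hn hw]
    rcases h with h | h <;> rw [h]
    rw [inv_inv, Set.union_comm]

/-! ### Component indices and the number of points -/

lemma ncard_sUnion_eq_mul {X : Type*} {S : Set (Set X)} (hS : S.Finite) (m : ℕ)
    (hfin : ∀ O ∈ S, O.Finite) (hm : ∀ O ∈ S, O.ncard = m) (hd : S.PairwiseDisjoint id) :
    (⋃₀ S).ncard = m * S.ncard := by
  induction S, hS using Set.Finite.induction_on with
  | empty => simp
  | @insert O S hO hS ih =>
    rw [Set.sUnion_insert, Set.ncard_union_eq _ (hfin O (by simp))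
      (hS.sUnion fun P hP => hfin P (by simp [hP])), ih (fun P hP => hfin P (by simp [hP]))
      (fun P hP => hm P (by simp [hP])) (hd.subset (Set.subset_insert _ _)), hm O (by simp),
      Set.ncard_insert_of_notMem hO hS]
    · ring
    · rw [Set.disjoint_sUnion_right]
      intro P hP
      exact hd (by simp) (by simp [hP]) (fun h => hO (h ▸ hP))

lemma ncard_setOf_eq_and {X : Type*} (a : X) (P : X → Prop) [Decidable (P a)] :
    {x | x = a ∧ P x}.ncard = if P a then 1 else 0 := by
  split_ifs with h
  · rw [Set.ncard_eq_one]
    exact ⟨a, by ext x; simp only [Set.mem_ofPred_eq, Set.mem_singleton_iff]; grind⟩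
  · convert Set.ncard_empty X
    ext x
    simp only [Set.mem_ofPred_eq, Set.mem_empty_iff_false]
    grind

lemma ncard_setOf_eq_or_eq_and {X : Type*} {a b : X} (hab : a ≠ b) (P : X → Prop) [Decidable (P a)]
    [Decidable (P b)] :
    {x | (x = a ∨ x = b) ∧ P x}.ncard = (if P a then 1 else 0) + (if P b then 1 else 0) := by
  have h : {x | (x = a ∨ x = b) ∧ P x} = {x | x = a ∧ P x} ∪ {x | x = b ∧ P x} := by
    ext x
    simp only [Set.mem_ofPred_eq, Set.mem_union]
    tauto
  have hf (c : X) : {x | x = c ∧ P x}.Finite :=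
    (Set.finite_singleton c).subset (by rintro x ⟨rfl, -⟩; rfl)
  rw [h, Set.ncard_union_eq _ (hf a) (hf b), ncard_setOf_eq_and, ncard_setOf_eq_and]
  rw [Set.disjoint_left]
  rintro x ⟨rfl, -⟩ ⟨h, -⟩
  exact hab h

lemma orbitA_ne_orbitB {n : ℕ} (hn : n ≠ 0) : orbitA n ≠ orbitB n := by
  intro h
  have : ((1 : ℂ) : OnePoint ℂ) ∈ orbitA n := (coe_mem_orbitA hn).2 (by simp)
  rw [h, coe_mem_orbitB hn] at this
  norm_num at this

open Classical in
lemma dihedralIndex_fst (n : ℕ) (α : Set (OnePoint ℂ)) :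
    (dihedralIndex n α).1 = if orbitV ⊆ α then 1 else 0 :=
  ncard_setOf_eq_and _ _

open Classical in
lemma dihedralIndex_snd_fst {n : ℕ} (hn : n ≠ 0) (α : Set (OnePoint ℂ)) :
    (dihedralIndex n α).2.1 = (if orbitA n ⊆ α then 1 else 0) + (if orbitB n ⊆ α then 1 else 0) :=
  ncard_setOf_eq_or_eq_and (orbitA_ne_orbitB hn) _

lemma orbitV_ne_orbitA (n : ℕ) : orbitV ≠ orbitA n := fun h =>
  infty_notMem_orbitA (n := n) (h ▸ infty_mem_orbitV)

lemma orbitV_ne_orbitB (n : ℕ) : orbitV ≠ orbitB n := fun h =>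
  infty_notMem_orbitB (n := n) (h ▸ infty_mem_orbitV)

/-- At `n = 2` the Klein index merely forgets which special orbits lie on the circle, so everything
can be computed with `dihedralIndex 2`. -/
lemma kleinIndex_eq (α : Set (OnePoint ℂ)) :
    kleinIndex α = ((dihedralIndex 2 α).1 + (dihedralIndex 2 α).2.1, (dihedralIndex 2 α).2.2) := by
  have h : {O : Set (OnePoint ℂ) | (O = orbitV ∨ O = orbitA 2 ∨ O = orbitB 2) ∧ O ⊆ α} =
      {O | O = orbitV ∧ O ⊆ α} ∪ {O | (O = orbitA 2 ∨ O = orbitB 2) ∧ O ⊆ α} := by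
    ext x
    simp only [Set.mem_ofPred_eq, Set.mem_union]
    tauto
  rw [kleinIndex, h, Set.ncard_union_eq ?_ ?_ ?_]
  · rfl
  · rw [Set.disjoint_left]
    rintro x ⟨rfl, -⟩ ⟨h | h, -⟩
    · exact orbitV_ne_orbitA 2 h
    · exact orbitV_ne_orbitB 2 h
  · exact (Set.finite_singleton orbitV).subset (by rintro x ⟨rfl, -⟩; rfl)
  · exact (Set.toFinite {orbitA 2, orbitB 2}).subset (by rintro x ⟨h, -⟩; exact h)

lemma dihedralIndex_fst_le (n : ℕ) (α : Set (OnePoint ℂ)) : (dihedralIndex n α).1 ≤ 1 := by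
  rw [dihedralIndex_fst]
  split_ifs <;> simp

/-- The number of points of a finite invariant set, in terms of its component index. -/
lemma ncard_eq_of_invariant {n : ℕ} (hn : n ≠ 0) {α : Set (OnePoint ℂ)} (hfin : α.Finite)
    (hα : stdDihedral n ≤ moebiusStabilizer α) :
    α.ncard = 2 * (dihedralIndex n α).1 +
      n * ((dihedralIndex n α).2.1 + 2 * (dihedralIndex n α).2.2) := by
  set SV := {O : Set (OnePoint ℂ) | O = orbitV ∧ O ⊆ α} with hSV
  set SA := {O : Set (OnePoint ℂ) | (O = orbitA n ∨ O = orbitB n) ∧ O ⊆ α} with hSA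
  set SC := {O : Set (OnePoint ℂ) | O ∈ typeC n ∧ O ⊆ α} with hSC
  have hpow := hfin.finite_subsets
  have fV : SV.Finite := hpow.subset fun O hO => hO.2
  have fA : SA.Finite := hpow.subset fun O hO => hO.2
  have fC : SC.Finite := hpow.subset fun O hO => hO.2
  have cV : (⋃₀ SV).ncard = 2 * SV.ncard := by
    apply ncard_sUnion_eq_mul fV 2 (fun O hO => hfin.subset hO.2)
    · rintro O ⟨rfl, -⟩
      exact ncard_orbitV
    · rintro O ⟨rfl, -⟩ O' ⟨rfl, -⟩ h
      exact absurd rfl h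
  have cA : (⋃₀ SA).ncard = n * SA.ncard := by
    apply ncard_sUnion_eq_mul fA n (fun O hO => hfin.subset hO.2)
    · rintro O ⟨rfl | rfl, -⟩
      · exact ncard_orbitA hn
      · exact ncard_orbitB hn
    · have hd : Disjoint (orbitA n) (orbitB n) := by
        rw [Set.disjoint_left]
        intro p h1 h2
        rw [orbitA_eq hn] at h1
        obtain ⟨z, hz, rfl⟩ := h1
        rw [coe_mem_orbitB hn] at h2
        have := hz.symm.trans h2
        norm_num at this
      rintro O ⟨rfl | rfl, -⟩ O' ⟨rfl | rfl, -⟩ h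
      · exact absurd rfl h
      · exact hd
      · exact hd.symm
      · exact absurd rfl h
  have cC : (⋃₀ SC).ncard = (2 * n) * SC.ncard := by
    apply ncard_sUnion_eq_mul fC _ (fun O hO => hfin.subset hO.2)
    · rintro O ⟨hO, -⟩
      obtain ⟨z, hz, h1, h2, rfl⟩ := (mem_typeC_iff hn).1 hO
      exact ncard_orbitC hn hz h1 h2
    · rintro O ⟨hO, -⟩ O' ⟨hO', -⟩ h
      obtain ⟨z, hz, h1, h2, rfl⟩ := (mem_typeC_iff hn).1 hO
      obtain ⟨w, hw, -, -, rfl⟩ := (mem_typeC_iff hn).1 hO'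
      change Disjoint _ _
      rw [Set.disjoint_left]
      intro p (hp : p ∈ orbitC n z) (hp' : p ∈ orbitC n w)
      apply h
      rw [orbitC_eq_orbitC_iff hn hw hz]
      cases p with
      | infty => simp at hp
      | coe q =>
        rw [coe_mem_orbitC hn hz] at hp
        rw [coe_mem_orbitC hn hw] at hp'
        rcases hp with hp | hp <;> rcases hp' with hp' | hp' <;> rw [hp] at hp'
        · exact .inl hp'
        · exact .inr hp'
        · exact .inr (by rw [← hp', inv_inv])
        · exact .inl (inv_injective hp')
  have hU : α = ⋃₀ SV ∪ (⋃₀ SA ∪ ⋃₀ SC) := by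
    apply Set.Subset.antisymm
    · intro p hp
      cases p with
      | infty => exact .inl ⟨_, ⟨rfl, (orbitV_subset_iff_infty hα).2 hp⟩, by simp⟩
      | coe z =>
        by_cases hz : z = 0
        · subst hz
          exact .inl ⟨_, ⟨rfl, (orbitV_subset_iff_zero hα).2 hp⟩, coe_mem_orbitV.2 rfl⟩
        right
        by_cases h1 : z ^ n = 1
        · exact .inl ⟨_, ⟨.inl rfl, (orbitA_subset_iff hn hα h1).2 hp⟩, (coe_mem_orbitA hn).2 h1⟩
        by_cases h2 : z ^ n = -1
        · exact .inl ⟨_, ⟨.inr rfl, (orbitB_subset_iff hn hα h2).2 hp⟩, (coe_mem_orbitB hn).2 h2⟩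
        exact .inr ⟨_, ⟨(mem_typeC_iff hn).2 ⟨z, hz, h1, h2, rfl⟩, (orbitC_subset_iff hn hα hz).2 hp⟩,
          (coe_mem_orbitC hn hz).2 (.inl rfl)⟩
    · rw [Set.union_subset_iff, Set.union_subset_iff]
      exact ⟨Set.sUnion_subset fun O hO => hO.2, Set.sUnion_subset fun O hO => hO.2,
        Set.sUnion_subset fun O hO => hO.2⟩
  have d1 : Disjoint (⋃₀ SV) (⋃₀ SA ∪ ⋃₀ SC) := by
    rw [Set.disjoint_left]
    rintro p ⟨_, ⟨rfl, -⟩, hp⟩ h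
    rcases hp with rfl | rfl
    · rcases h with ⟨_, ⟨rfl | rfl, -⟩, h⟩ | ⟨O, ⟨hO, -⟩, h⟩
      · rw [coe_mem_orbitA hn] at h
        simp [hn] at h
      · rw [coe_mem_orbitB hn] at h
        simp [hn] at h
      · obtain ⟨z, hz, -, -, rfl⟩ := (mem_typeC_iff hn).1 hO
        rw [coe_mem_orbitC hn hz] at h
        simp [hn] at h
        exact hz (by simpa [hn] using h.symm)
    · rcases h with ⟨_, ⟨rfl | rfl, -⟩, h⟩ | ⟨O, ⟨hO, -⟩, h⟩
      · simp at h
      · simp at h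
      · obtain ⟨z, hz, -, -, rfl⟩ := (mem_typeC_iff hn).1 hO
        simp at h
  have d2 : Disjoint (⋃₀ SA) (⋃₀ SC) := by
    rw [Set.disjoint_left]
    rintro p ⟨_, ⟨hO', -⟩, hp⟩ ⟨O, ⟨hO, -⟩, h⟩
    obtain ⟨z, hz, h1, h2, rfl⟩ := (mem_typeC_iff hn).1 hO
    cases p with
    | infty => simp at h
    | coe w =>
      rw [coe_mem_orbitC hn hz] at h
      rcases hO' with rfl | rfl
      · rw [coe_mem_orbitA hn] at hp
        rw [hp] at h
        rcases h with h | h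
        · exact h1 h.symm
        · exact h1 (by rw [← inv_inv (z ^ n), ← h, inv_one])
      · rw [coe_mem_orbitB hn] at hp
        rw [hp] at h
        rcases h with h | h
        · exact h2 h.symm
        · exact h2 (by rw [← inv_inv (z ^ n), ← h]; norm_num)
  have fin {S : Set (Set (OnePoint ℂ))} (hS : ∀ O ∈ S, O ⊆ α) : (⋃₀ S).Finite :=
    hfin.subset (Set.sUnion_subset hS)
  have fV' := fin fun O (hO : O ∈ SV) => hO.2
  have fA' := fin fun O (hO : O ∈ SA) => hO.2
  have fC' := fin fun O (hO : O ∈ SC) => hO.2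
  conv_lhs => rw [hU]
  rw [Set.ncard_union_eq d1 fV' (fA'.union fC'), Set.ncard_union_eq d2 fA' fC', cV, cA, cC]
  change _ = 2 * SV.ncard + n * (SA.ncard + 2 * SC.ncard)
  ring

/-! ### Orbit unions, and stabilizers compared by order -/

/-- Orbits of a finite group are finite, and an invariant set is the union of the orbits of its own
points. -/
lemma isFiniteOrbitUnion_iff {n : ℕ} (hn : n ≠ 0) {α : Set (OnePoint ℂ)} :
    IsFiniteOrbitUnion n α ↔ α.Finite ∧ stdDihedral n ≤ moebiusStabilizer α := by
  constructor
  · rintro ⟨F, hF, rfl⟩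
    have := finite_stdDihedral hn
    refine ⟨hF.biUnion fun p _ => Set.finite_range _, fun f hf => ?_⟩
    refine mem_moebiusStabilizer.2 ⟨stdDihedral_le_moebiusGroup n hf, fun p => ?_⟩
    simp only [Set.mem_iUnion]
    refine exists_congr fun q => exists_congr fun _ => ?_
    change (⟨f, hf⟩ : stdDihedral n) • p ∈ _ ↔ _
    rw [← MulAction.orbit_eq_iff, MulAction.orbit_smul, MulAction.orbit_eq_iff]
  · rintro ⟨hfin, hα⟩
    refine ⟨α, hfin, Set.Subset.antisymm (fun p hp => ?_) ?_⟩
    · simp only [Set.mem_iUnion]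
      exact ⟨p, hp, MulAction.mem_orbit_self p⟩
    · simp only [Set.iUnion_subset_iff]
      rintro p hp _ ⟨f, rfl⟩
      exact ((mem_moebiusStabilizer.1 (hα f.2)).2 p).2 hp

/-- An invariant finite set with stabilizer isomorphic to the dihedral group has the standard
dihedral group as its stabilizer. -/
lemma moebiusStabilizer_eq_of_mulEquiv {n : ℕ} (hn : n ≠ 0) {α : Set (OnePoint ℂ)}
    (hα : stdDihedral n ≤ moebiusStabilizer α)
    (h : Nonempty (moebiusStabilizer α ≃* DihedralGroup n)) :
    moebiusStabilizer α = stdDihedral n := by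
  obtain ⟨e⟩ := h
  have hc : Nat.card (moebiusStabilizer α) = 2 * n := by
    rw [Nat.card_congr e.toEquiv, DihedralGroup.nat_card]
  have : Finite (moebiusStabilizer α) :=
    Nat.finite_of_card_ne_zero (by rw [hc]; positivity)
  exact (Subgroup.eq_of_le_of_card_ge hα (by rw [hc, card_stdDihedral hn])).symm

/-! ### Finite order of symmetries and infinite order of hyperbolic maps -/

lemma moebiusMap_eq_one {a b c d : ℂ} (h : a * d - b * c ≠ 0) (hb : b = 0) (hc : c = 0)
    (had : a = d) : moebiusMap a b c d h = 1 := by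
  subst hb hc had
  have ha : a ≠ 0 := by
    rintro rfl
    simp at h
  ext p
  cases p <;> simp [moebiusMap_coe, moebiusMap_infty, ha]

lemma moebiusMap_coe_eq_coe_iff {a b c d : ℂ} (h : a * d - b * c ≠ 0) {z w : ℂ} :
    moebiusMap a b c d h z = (w : OnePoint ℂ) ↔ c * z + d ≠ 0 ∧ a * z + b = w * (c * z + d) := by
  rw [moebiusMap_coe]
  split_ifs with h0
  · simp [h0]
  · simp [h0, div_eq_iff]

lemma moebiusMap_infty_eq_infty_iff {a b c d : ℂ} (h : a * d - b * c ≠ 0) :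
    moebiusMap a b c d h ∞ = ∞ ↔ c = 0 := by
  rw [moebiusMap_infty]
  split_ifs with h0 <;> simp [h0]

/-- A polynomial of degree at most two with three distinct roots vanishes. -/
lemma quadratic_eq_zero_of_three_roots {a b c x y z : ℂ} (hxy : x ≠ y) (hxz : x ≠ z) (hyz : y ≠ z)
    (hx : a * x ^ 2 + b * x + c = 0) (hy : a * y ^ 2 + b * y + c = 0)
    (hz : a * z ^ 2 + b * z + c = 0) : a = 0 ∧ b = 0 ∧ c = 0 := by
  have e1 : a * (x + y) + b = 0 := by
    apply mul_left_cancel₀ (sub_ne_zero.2 hxy)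
    linear_combination hx - hy
  have e2 : a * (x + z) + b = 0 := by
    apply mul_left_cancel₀ (sub_ne_zero.2 hxz)
    linear_combination hx - hz
  have ha : a = 0 := by
    apply mul_left_cancel₀ (sub_ne_zero.2 hyz)
    linear_combination e1 - e2
  subst ha
  have hb : b = 0 := by linear_combination e1
  subst hb
  exact ⟨rfl, rfl, by linear_combination hx⟩

/-- A Möbius transformation fixing three points is the identity. -/
lemma eq_one_of_fixes_three {f : Equiv.Perm (OnePoint ℂ)} (hf : f ∈ moebiusGroup)
    {α : Set (OnePoint ℂ)} (h3 : 3 ≤ α.ncard) (hfix : ∀ p ∈ α, f p = p) : f = 1 := by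
  obtain ⟨a, b, c, d, h, rfl⟩ := exists_eq_moebiusMap hf
  -- Finite fixed points are roots of one quadratic. If `∞` is fixed too, its leading coefficient
  -- `c` vanishes and two finite points suffice.
  have hroot {z : ℂ} (hz : (z : OnePoint ℂ) ∈ α) : c * z ^ 2 + (d - a) * z + -b = 0 := by
    have := ((moebiusMap_coe_eq_coe_iff h).1 (hfix _ hz)).2
    linear_combination -this
  obtain ⟨p, q, r, hp, hq, hr, hpq, hpr, hqr⟩ := (Set.two_lt_ncard_iff
    (Set.finite_of_ncard_ne_zero (by lia))).1 h3
  have key {x y : ℂ} (hx : (x : OnePoint ℂ) ∈ α) (hy : (y : OnePoint ℂ) ∈ α) (hxy : x ≠ y)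
      (hi : ∞ ∈ α) : moebiusMap a b c d h = 1 := by
    have hc := (moebiusMap_infty_eq_infty_iff h).1 (hfix _ hi)
    have e1 := hroot hx
    have e2 := hroot hy
    rw [hc] at e1 e2
    have hda : d - a = 0 := by
      apply mul_left_cancel₀ (sub_ne_zero.2 hxy)
      linear_combination e1 - e2
    rw [hda] at e1
    exact moebiusMap_eq_one h (by linear_combination -e1) hc (by linear_combination -hda)
  have hcoe {x y : ℂ} (hxy : (x : OnePoint ℂ) ≠ y) : x ≠ y := fun h => hxy (by rw [h])
  induction p using OnePoint.rec with
  | infty =>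
    induction q using OnePoint.rec with
    | infty => exact absurd rfl hpq
    | coe y =>
      induction r using OnePoint.rec with
      | infty => exact absurd rfl hpr
      | coe z => exact key hq hr (hcoe hqr) hp
  | coe x =>
    induction q using OnePoint.rec with
    | infty =>
      induction r using OnePoint.rec with
      | infty => exact absurd rfl hqr
      | coe z => exact key hp hr (hcoe hpr) hq
    | coe y =>
      induction r using OnePoint.rec with
      | infty => exact key hp hq (hcoe hpq) hr
      | coe z =>
        obtain ⟨hc, hda, hb⟩ := quadratic_eq_zero_of_three_roots (hcoe hpq) (hcoe hpr) (hcoe hqr)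
          (hroot hp) (hroot hq) (hroot hr)
        exact moebiusMap_eq_one h (by linear_combination -hb) hc (by linear_combination -hda)

/-- The stabilizer acts faithfully on `α`, since three fixed points force the identity. So the order
of the symmetric group of `α` is a valid exponent. -/
lemma exists_pow_eq_one_of_mem_moebiusStabilizer {α : Set (OnePoint ℂ)} (h3 : 3 ≤ α.ncard)
    {f : Equiv.Perm (OnePoint ℂ)} (hf : f ∈ moebiusStabilizer α) : ∃ m ≠ 0, f ^ m = 1 := by
  have : Finite α := Set.finite_of_ncard_ne_zero (by lia)
  obtain ⟨hf1, hf2⟩ := mem_moebiusStabilizer.1 hf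
  refine ⟨Nat.card (Equiv.Perm α), Nat.card_pos.ne',
    eq_one_of_fixes_three (Subgroup.pow_mem _ hf1 _) h3 fun p hp => ?_⟩
  have h1 : (f.subtypePerm hf2) ^ Nat.card (Equiv.Perm α) = 1 := pow_card_eq_one'
  rw [Equiv.Perm.subtypePerm_pow] at h1
  exact congrArg Subtype.val (Equiv.congr_fun h1 ⟨p, hp⟩)

lemma entries_of_toPermHom_eq_one {M : GL (Fin 2) ℂ}
    (h : MulAction.toPermHom (GL (Fin 2) ℂ) (OnePoint ℂ) M = 1) :
    M 0 1 = 0 ∧ M 1 0 = 0 ∧ M 0 0 = M 1 1 := by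
  obtain ⟨h0, e⟩ := toPermHom_eq_moebiusMap M
  rw [e] at h
  have hi := (moebiusMap_infty_eq_infty_iff h0).1 (by rw [h]; rfl)
  have hz := ((moebiusMap_coe_eq_coe_iff h0 (z := 0) (w := 0)).1 (by rw [h]; rfl)).2
  have h1 := ((moebiusMap_coe_eq_coe_iff h0 (z := 1) (w := 1)).1 (by rw [h]; rfl)).2
  have hb : M 0 1 = 0 := by linear_combination hz
  exact ⟨hb, hi, by linear_combination h1 - hb + hi⟩

/-- A hyperbolic Möbius transformation has infinite order. -/
lemma toPermHom_pow_ne_one {M : GL (Fin 2) ℂ} {t : ℝ} (ht : 2 < t)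
    (hdet : M 0 0 * M 1 1 - M 0 1 * M 1 0 = 1) (htr : M 0 0 + M 1 1 = t) {m : ℕ} (hm : m ≠ 0) :
    MulAction.toPermHom (GL (Fin 2) ℂ) (OnePoint ℂ) M ^ m ≠ 1 := by
  -- Cayley–Hamilton for determinant `1` and trace `t`.
  have hsq : (M : Matrix (Fin 2) (Fin 2) ℂ) * M = (t : ℂ) • (M : Matrix (Fin 2) (Fin 2) ℂ) - 1 := by
    ext i j
    fin_cases i <;> fin_cases j <;>
      simp [Matrix.mul_apply, Fin.sum_univ_two, ← htr] <;> first | linear_combination -hdet | ring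
  -- Every positive power is `x M - y` with `x > y ≥ 0`. The next pair is `(x t - y, x)`, and `t >
  -- 2` preserves the inequality. As `x ≠ 0`, a power acting trivially makes `M` itself scalar, so
  -- `t ^ 2 = 4`.
  have hpow : ∀ k : ℕ, ∃ x y : ℝ, 0 ≤ y ∧ y < x ∧
      ((M ^ (k + 1) : GL (Fin 2) ℂ) : Matrix (Fin 2) (Fin 2) ℂ) =
        (x : ℂ) • (M : Matrix (Fin 2) (Fin 2) ℂ) - (y : ℂ) • 1 := by
    intro k
    induction k with
    | zero => exact ⟨1, 0, le_rfl, one_pos, by simp⟩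
    | succ k ih =>
      obtain ⟨x, y, hy, hxy, e⟩ := ih
      refine ⟨x * t - y, x, by linarith, by nlinarith, ?_⟩
      rw [pow_succ, Units.val_mul, e, sub_mul, Matrix.smul_mul, hsq, Matrix.smul_mul, one_mul]
      push_cast
      module
  intro h
  rw [← map_pow] at h
  obtain ⟨k, rfl⟩ := Nat.exists_eq_succ_of_ne_zero hm
  obtain ⟨x, y, hy, hxy, e⟩ := hpow k
  obtain ⟨h1, h2, h3⟩ := entries_of_toPermHom_eq_one h
  have hx : (x : ℂ) ≠ 0 := by exact_mod_cast (by linarith : x ≠ 0)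
  have e' (i j) : (M ^ (k + 1) : GL (Fin 2) ℂ) i j =
      x * M i j - y * (1 : Matrix (Fin 2) (Fin 2) ℂ) i j := by
    rw [e]
    simp
  rw [Nat.succ_eq_add_one, e'] at h1 h2 h3
  rw [e'] at h3
  simp [hx] at h1 h2 h3
  rw [h1, ← h3] at hdet
  rw [← h3] at htr
  have h4 : (t : ℂ) ^ 2 = 4 := by
    rw [← htr]
    linear_combination 4 * hdet
  have h5 : t ^ 2 = 4 := by exact_mod_cast h4
  nlinarith

/-! ### Rigidity of sets with many points on the unit circle -/

open scoped ComplexConjugate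

lemma mul_conj_of_norm_one {z : ℂ} (hz : ‖z‖ = 1) : z * conj z = 1 := by
  rw [Complex.mul_conj, Complex.normSq_eq_norm_sq, hz]
  simp

/-- A Möbius transformation mapping three points of the unit circle to the unit circle satisfies
the equations that characterize the transformations preserving the unit circle. -/
lemma circle_equations {a b c d : ℂ} (h : a * d - b * c ≠ 0) {S : Set ℂ} (h3 : 3 ≤ S.ncard)
    (hS : ∀ z ∈ S, ‖z‖ = 1) (hS' : ∀ z ∈ S, ∃ w : ℂ, ‖w‖ = 1 ∧ moebiusMap a b c d h z = w) :
    a * conj b = c * conj d ∧ a * conj a + b * conj b = c * conj c + d * conj d := by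
  -- The equation `|a z + b|² = |c z + d|²`, multiplied by `z` and simplified with `z * conj z = 1`,
  -- is a quadratic equation in `z`. Three roots make all its coefficients vanish.
  have hroot {z : ℂ} (hz : z ∈ S) : (a * conj b - c * conj d) * z ^ 2 +
      (a * conj a + b * conj b - c * conj c - d * conj d) * z + conj (a * conj b - c * conj d) = 0 := by
    obtain ⟨w, hw, e⟩ := hS' z hz
    have e1 := ((moebiusMap_coe_eq_coe_iff h).1 e).2
    have e2 := congrArg conj e1
    have hz1 := mul_conj_of_norm_one (hS z hz)
    have hw1 := mul_conj_of_norm_one hw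
    simp only [map_add, map_mul, map_sub, Complex.conj_conj] at e2 ⊢
    linear_combination z * (conj a * conj z + conj b) * e1 + z * w * (c * z + d) * e2
      + z * (c * z + d) * (conj c * conj z + conj d) * hw1
      + (z * conj c * c + conj c * d - z * a * conj a - conj a * b) * hz1
  obtain ⟨x, y, z, hx, hy, hz, hxy, hxz, hyz⟩ := (Set.two_lt_ncard_iff
    (Set.finite_of_ncard_ne_zero (by lia))).1 h3
  obtain ⟨h1, h2, -⟩ := quadratic_eq_zero_of_three_roots hxy hxz hyz (hroot hx) (hroot hy) (hroot hz)
  exact ⟨by linear_combination h1, by linear_combination h2⟩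

lemma moebiusMap_diag {a d : ℂ} (h : a * d - 0 * 0 ≠ 0) :
    ∃ u, moebiusMap a 0 0 d h = scaleMap u := by
  have ha : a ≠ 0 := by
    rintro rfl
    simp at h
  have hd : d ≠ 0 := by
    rintro rfl
    simp at h
  refine ⟨Units.mk0 (a / d) (div_ne_zero ha hd), ?_⟩
  ext p
  cases p <;> simp [moebiusMap_coe, moebiusMap_infty, hd, div_mul_eq_mul_div]

/-- For `|ζ| = 1` and `ζ ≠ 1` the last factor is the positive number `2 - 2 Re ζ`. The commutator
therefore has real trace above `2` as soon as `b c / (a d - b c)` is positive. -/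
lemma trace_commutator_diag (g D : GL (Fin 2) ℂ) (ζ : ℂ) (hD : (D : Matrix (Fin 2) (Fin 2) ℂ) = !![ζ, 0; 0, 1]) :
    (D * g * D⁻¹ * g⁻¹) 0 0 + (D * g * D⁻¹ * g⁻¹) 1 1 =
      2 + g 0 1 * g 1 0 / (g 0 0 * g 1 1 - g 0 1 * g 1 0) * (2 - ζ - ζ⁻¹) := by
  have hdet := g.det_ne_zero
  rw [Matrix.det_fin_two] at hdet
  have hζ : ζ ≠ 0 := by simpa [hD] using D.det_ne_zero
  simp [Matrix.mul_apply, Matrix.vecMul_eq_sum, Fin.sum_univ_two, hD, Matrix.inv_def, Matrix.adjugate_fin_two,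
    Matrix.det_fin_two, Ring.inverse_eq_inv']
  field_simp
  ring

/-- An element of the stabilizer of a finite set that preserves the unit circle and the two sides
of the circle, commutes with the rotations in the stabilizer. -/
lemma scaleMap_of_circle_equations {α : Set (OnePoint ℂ)} (hα : 3 ≤ α.ncard) {ζ : ℂˣ}
    (hζ : ‖(ζ : ℂ)‖ = 1) (hζ1 : ζ ≠ 1) (hζα : scaleMap ζ ∈ moebiusStabilizer α) {a b c d : ℂ}
    (h : a * d - b * c ≠ 0) (hg : moebiusMap a b c d h ∈ moebiusStabilizer α)
    (h1 : a * conj b = c * conj d) (hlt : ‖b‖ < ‖d‖) :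
    ∃ u, moebiusMap a b c d h = scaleMap u := by
  have hd : d ≠ 0 := norm_pos_iff.1 ((norm_nonneg b).trans_lt hlt)
  by_cases hb : b = 0
  · subst hb
    have hc : c = 0 := by simpa [hd] using h1.symm
    subst hc
    exact moebiusMap_diag h
  exfalso
  have hpos : 0 < ‖d‖ ^ 2 - ‖b‖ ^ 2 := by nlinarith [norm_nonneg b]
  -- The circle equation `a * conj b = c * conj d` turns `b c / (a d - b c)` into this real number,
  -- positive when `b ≠ 0` and `|b| < |d|`.
  set s : ℝ := ‖b‖ ^ 2 / (‖d‖ ^ 2 - ‖b‖ ^ 2) with hs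
  have hspos : 0 < s := div_pos (by positivity) hpos
  have hbc : b * c / (a * d - b * c) = (s : ℂ) := by
    have hpos' : ((‖d‖ ^ 2 - ‖b‖ ^ 2 : ℝ) : ℂ) ≠ 0 := by exact_mod_cast hpos.ne'
    rw [hs, Complex.ofReal_div, div_eq_div_iff h hpos']
    push_cast
    rw [← Complex.mul_conj', ← Complex.mul_conj']
    linear_combination -b * d * h1
  have hinv : (ζ : ℂ)⁻¹ = conj (ζ : ℂ) :=
    inv_eq_of_mul_eq_one_right (mul_conj_of_norm_one hζ)
  have hre : (ζ : ℂ).re < 1 := by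
    refine lt_of_le_of_ne (hζ ▸ Complex.re_le_norm _) fun hre => hζ1 (Units.ext ?_)
    have hn : (ζ : ℂ).re ^ 2 + (ζ : ℂ).im ^ 2 = 1 := by
      rw [← Complex.sq_norm_sub_sq_re, hζ]
      ring
    apply Complex.ext
    · simpa using hre
    · rw [hre] at hn
      have : (ζ : ℂ).im = 0 := by nlinarith
      simpa using this
  set g : GL (Fin 2) ℂ := Matrix.GeneralLinearGroup.mkOfDetNeZero !![a, b; c, d]
    (by simpa [Matrix.det_fin_two] using h) with hg_def
  set D : GL (Fin 2) ℂ := Matrix.GeneralLinearGroup.mkOfDetNeZero !![(ζ : ℂ), 0; 0, 1]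
    (by simp) with hD_def
  have hgm : MulAction.toPermHom (GL (Fin 2) ℂ) (OnePoint ℂ) g = moebiusMap a b c d h := rfl
  have hDm : MulAction.toPermHom (GL (Fin 2) ℂ) (OnePoint ℂ) D = scaleMap ζ := rfl
  obtain ⟨m, hm, hpow⟩ := exists_pow_eq_one_of_mem_moebiusStabilizer hα
    (f := MulAction.toPermHom (GL (Fin 2) ℂ) (OnePoint ℂ) (D * g * D⁻¹ * g⁻¹)) (by
      rw [map_mul, map_mul, map_mul, map_inv, map_inv, hgm, hDm]
      exact Subgroup.mul_mem _ (Subgroup.mul_mem _ (Subgroup.mul_mem _ hζα hg)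
        (Subgroup.inv_mem _ hζα)) (Subgroup.inv_mem _ hg))
  refine toPermHom_pow_ne_one (t := 2 + s * (2 - 2 * (ζ : ℂ).re)) ?_ ?_ ?_ hm hpow
  · nlinarith
  · rw [← Matrix.det_fin_two]
    have : (D * g * D⁻¹ * g⁻¹).det = 1 := by
      rw [map_mul, map_mul, map_mul, map_inv, map_inv]
      exact mul_inv_eq_one.2 (mul_inv_cancel_comm _ _)
    exact congrArg Units.val this
  · rw [trace_commutator_diag g D ζ rfl]
    have : g 0 1 * g 1 0 / (g 0 0 * g 1 1 - g 0 1 * g 1 0) = s := hbc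
    rw [this, hinv]
    push_cast
    rw [sub_sub, Complex.add_conj]
    push_cast
    ring

lemma moebiusMap_mul_inversionMap {a b c d : ℂ} (h : a * d - b * c ≠ 0) :
    ∃ h', moebiusMap a b c d h * inversionMap = moebiusMap b a d c h' := by
  have h' : b * c - a * d ≠ 0 := fun e => h (by linear_combination -e)
  refine ⟨h', ?_⟩
  ext p
  induction p using OnePoint.rec with
  | infty => simp [moebiusMap_coe, moebiusMap_infty]
  | coe z =>
    by_cases hz : z = 0
    · simp [hz, moebiusMap_coe, moebiusMap_infty]
    · rw [Equiv.Perm.mul_apply, inversionMap_coe hz, moebiusMap_coe, moebiusMap_coe]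
      have e : c * z⁻¹ + d = (d * z + c) / z := by
        field_simp
        ring
      have e' : a * z⁻¹ + b = (b * z + a) / z := by
        field_simp
        ring
      rw [e, e', div_div_div_cancel_right₀ hz]
      simp [hz]

/-- Rigidity: if a finite set has more than enough points on the unit circle, and admits a
nontrivial rotation and the inversion, then its stabilizer consists of scalings and of their
products with the inversion. -/
lemma scaleMap_of_mem_moebiusStabilizer {α : Set (OnePoint ℂ)} {ζ : ℂˣ}
    (hζ : ‖(ζ : ℂ)‖ = 1) (hζ1 : ζ ≠ 1) (hζα : scaleMap ζ ∈ moebiusStabilizer α)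
    (hinv : inversionMap ∈ moebiusStabilizer α) {S T : Set (OnePoint ℂ)} (hST : α = S ∪ T)
    (hS : ∀ p ∈ S, ∃ z : ℂ, ‖z‖ = 1 ∧ p = z) (hT : T.Finite) (hcard : 3 + T.ncard ≤ S.ncard)
    {f : Equiv.Perm (OnePoint ℂ)} (hf : f ∈ moebiusStabilizer α) :
    ∃ u : ℂˣ, ‖(u : ℂ)‖ = 1 ∧ (f = scaleMap u ∨ f = scaleMap u * inversionMap) := by
  have hSfin : S.Finite := Set.finite_of_ncard_ne_zero (by lia)
  have hαfin : α.Finite := hST ▸ hSfin.union hT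
  have hα : 3 ≤ α.ncard := by
    have := Set.ncard_le_ncard (s := S) (t := α) (hST ▸ Set.subset_union_left) hαfin
    lia
  obtain ⟨hfm, hfα⟩ := mem_moebiusStabilizer.1 hf
  obtain ⟨a, b, c, d, h, rfl⟩ := exists_eq_moebiusMap hfm
  set g := moebiusMap a b c d h with hg
  set S' : Set (OnePoint ℂ) := {p ∈ S | g p ∈ S} with hS'
  -- The points of `S` leaving `S` are sent injectively into `T`, so at least three remain.
  have hS'card : 3 ≤ S'.ncard := by
    have h1 : (S \ S').ncard ≤ T.ncard := by
      refine Set.ncard_le_ncard_of_injOn g ?_ g.injective.injOn hT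
      rintro p ⟨hp, hp'⟩
      have : g p ∈ S ∪ T := hST ▸ (hfα p).2 (hST ▸ .inl hp)
      exact this.resolve_left fun h => hp' ⟨hp, h⟩
    have h2 := Set.ncard_sdiff_add_ncard_of_subset (s := S') (t := S) (fun p hp => hp.1) hSfin
    lia
  set Z : Set ℂ := {z | (z : OnePoint ℂ) ∈ S'} with hZ
  have hZ' : S' = (fun z : ℂ => (z : OnePoint ℂ)) '' Z := by
    ext p
    constructor
    · intro hp
      obtain ⟨z, -, rfl⟩ := hS p hp.1
      exact ⟨z, hp, rfl⟩
    · rintro ⟨z, hz, rfl⟩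
      exact hz
  have hSz {z : ℂ} (hz : (z : OnePoint ℂ) ∈ S) : ‖z‖ = 1 := by
    obtain ⟨w, hw, e⟩ := hS z hz
    rwa [OnePoint.coe_eq_coe.1 e]
  have hZcard : 3 ≤ Z.ncard := by
    rwa [hZ', Set.ncard_image_of_injective _ OnePoint.coe_injective] at hS'card
  obtain ⟨h1, h2⟩ := circle_equations h hZcard (fun z hz => hSz hz.1) (fun z hz => hS _ hz.2)
  obtain ⟨z₀, hz₀⟩ : Z.Nonempty := Set.nonempty_of_ncard_ne_zero (by lia)
  obtain ⟨w₀, hw₀, e₀⟩ := hS _ hz₀.2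
  have hz₁ := hSz hz₀.1
  have hz₂ : z₀ ≠ 0 := by
    rintro rfl
    simp at hz₁
  have h2' : ‖a‖ ^ 2 + ‖b‖ ^ 2 = ‖c‖ ^ 2 + ‖d‖ ^ 2 := by
    simp only [Complex.mul_conj'] at h2
    exact_mod_cast h2
  -- Since `g(0) = b/d`, the cases say that the image of `0` is inside, on or outside the unit
  -- circle. On the circle the determinant vanishes; outside, composition with the inversion
  -- replaces `(b, d)` by `(a, c)`, and `|a| < |c|` by `h2'`.
  rcases lt_trichotomy ‖b‖ ‖d‖ with hlt | heq | hgt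
  · obtain ⟨u, hu⟩ := scaleMap_of_circle_equations hα hζ hζ1 hζα h hf h1 hlt
    refine ⟨u, ?_, .inl hu⟩
    rw [hg, hu, scaleMap_coe, OnePoint.coe_eq_coe] at e₀
    rw [← hw₀, ← e₀, norm_mul, hz₁, mul_one]
  · exfalso
    apply h
    have hac : ‖a‖ = ‖c‖ := by
      rw [heq] at h2'
      exact (sq_eq_sq₀ (norm_nonneg _) (norm_nonneg _)).1 (by linarith)
    by_cases hb : b = 0
    · have hd : d = 0 := by simpa [hb] using heq.symm
      simp [hb, hd]
    · have hb' : conj b ≠ 0 := by simpa using hb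
      have e : b * conj b = d * conj d := by
        rw [Complex.mul_conj', Complex.mul_conj', heq]
      apply mul_left_cancel₀ hb'
      linear_combination d * h1 - c * e
  · obtain ⟨h', e'⟩ := moebiusMap_mul_inversionMap h
    have hlt : ‖a‖ < ‖c‖ := by
      apply lt_of_pow_lt_pow_left₀ 2 (norm_nonneg _)
      nlinarith [norm_nonneg d]
    have h1' := congrArg conj h1
    simp only [map_mul, Complex.conj_conj] at h1'
    obtain ⟨u, hu⟩ := scaleMap_of_circle_equations hα hζ hζ1 hζα h'
      (e' ▸ Subgroup.mul_mem _ hf hinv) (by linear_combination h1') hlt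
    have hfu : moebiusMap a b c d h = scaleMap u * inversionMap := by
      rw [← hu, ← e', mul_assoc, inversionMap_mul_self, mul_one]
    refine ⟨u, ?_, .inr hfu⟩
    rw [hg, hfu, Equiv.Perm.mul_apply, inversionMap_coe hz₂, scaleMap_coe, OnePoint.coe_eq_coe] at e₀
    rw [← hw₀, ← e₀, norm_mul, norm_inv, hz₁, inv_one, mul_one]

/-- Multiplication by `c` permutes `T`, hence multiplies the sum of `T` by `c` and also leaves it
unchanged. -/
lemma eq_one_of_mul_mem {T : Set ℂ} (hT : T.Finite) (hsum : ∑ᶠ t ∈ T, t ≠ 0) {c : ℂ} (hc0 : c ≠ 0)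
    (hc : ∀ t ∈ T, c * t ∈ T) : c = 1 := by
  have himg : (c * ·) '' T = T := Set.eq_of_subset_of_ncard_le (Set.image_subset_iff.2 hc)
    (Set.ncard_image_of_injective _ (mul_right_injective₀ hc0)).ge hT
  have h1 : ∑ᶠ t ∈ T, t = c * ∑ᶠ t ∈ T, t := by
    conv_lhs => rw [← himg]
    rw [finsum_mem_image (mul_right_injective₀ hc0).injOn, ← mul_finsum_mem]
  exact (mul_eq_right₀ hsum).1 h1.symm

/-- The stabilizer of a finite invariant set with sufficiently many points on the unit circle is
the dihedral group, provided that the `n`-th powers of these points have non-zero sum. -/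
lemma moebiusStabilizer_eq_of_sum_ne_zero {n : ℕ} (hn : 2 ≤ n) {α : Set (OnePoint ℂ)}
    (hα : stdDihedral n ≤ moebiusStabilizer α) {S T : Set (OnePoint ℂ)} (hST : α = S ∪ T)
    (hS : ∀ p ∈ S, ∃ z : ℂ, ‖z‖ = 1 ∧ p = z) (hT : T.Finite) (hTV : T ⊆ orbitV)
    (hcard : 3 + T.ncard ≤ S.ncard) {W : Set ℂ} (hW : ∀ w, w ∈ W ↔ ∃ z : ℂ, (z : OnePoint ℂ) ∈ S ∧ z ^ n = w)
    (hsum : ∑ᶠ w ∈ W, w ≠ 0) : moebiusStabilizer α = stdDihedral n := by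
  have hn0 : n ≠ 0 := by lia
  refine le_antisymm (fun f hf => ?_) hα
  have hζ1 : circleUnit (1 / n) ≠ 1 := by
    have := (isPrimitiveRoot_circleUnit hn0).ne_one (by lia)
    exact this
  have hrot : scaleMap (circleUnit (1 / n)) ∈ moebiusStabilizer α :=
    hα ((mem_stdDihedral_iff hn0).2 ⟨_, (isPrimitiveRoot_circleUnit hn0).pow_eq_one, .inl rfl⟩)
  have hinv := hα (inversionMap_mem_stdDihedral n)
  obtain ⟨u, hu, hfu⟩ := scaleMap_of_mem_moebiusStabilizer (norm_circlePoint _) hζ1 hrot hinv hST hS hT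
    hcard hf
  refine (mem_stdDihedral_iff hn0).2 ⟨u, ?_, hfu⟩
  have huα : scaleMap u ∈ moebiusStabilizer α := by
    rcases hfu with rfl | rfl
    · exact hf
    · exact (Subgroup.mul_mem_cancel_right _ hinv).1 hf
  have hSfin : S.Finite := Set.finite_of_ncard_ne_zero (by lia)
  have hWfin : W.Finite := by
    have : (((fun z : ℂ => (z : OnePoint ℂ)) ⁻¹' S)).Finite :=
      hSfin.preimage OnePoint.coe_injective.injOn
    refine (this.image (· ^ n)).subset fun w hw => ?_
    obtain ⟨z, hz, e⟩ := (hW w).1 hw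
    exact ⟨z, hz, e⟩
  have := eq_one_of_mul_mem hWfin hsum (c := (u : ℂ) ^ n) (pow_ne_zero _ u.ne_zero) (fun t ht => by
    obtain ⟨z, hz, rfl⟩ := (hW t).1 ht
    refine (hW _).2 ⟨u * z, ?_, mul_pow _ _ _⟩
    have h1 := ((mem_moebiusStabilizer.1 huα).2 z).2 (hST ▸ .inl hz)
    rw [scaleMap_coe, hST] at h1
    -- The point `u * z` has norm `1`, so it is not in `{0, ∞}` and must lie in `S`.
    refine h1.resolve_right fun h2 => ?_
    obtain ⟨w, hw, e⟩ := hS _ hz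
    have h3 := coe_mem_orbitV.1 (hTV h2)
    rw [OnePoint.coe_eq_coe] at e
    rw [e] at h3
    have h4 := congrArg norm h3
    simp [hu, hw] at h4)
  exact Units.ext (by simpa using this)

/-! ### Conjugating a dihedral group to standard position -/

lemma eq_scaleMap_of_fixes {f : Equiv.Perm (OnePoint ℂ)} (hf : f ∈ moebiusGroup)
    (h0 : f ((0 : ℂ) : OnePoint ℂ) = ((0 : ℂ) : OnePoint ℂ)) (hi : f ∞ = ∞) :
    ∃ u, f = scaleMap u := by
  obtain ⟨a, b, c, d, h, rfl⟩ := exists_eq_moebiusMap hf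
  have hc := (moebiusMap_infty_eq_infty_iff h).1 hi
  have hb : b = 0 := by simpa using ((moebiusMap_coe_eq_coe_iff h).1 h0).2
  subst hc hb
  exact moebiusMap_diag h

lemma eq_scaleMap_mul_inversionMap_of_swaps {f : Equiv.Perm (OnePoint ℂ)} (hf : f ∈ moebiusGroup)
    (h0 : f ((0 : ℂ) : OnePoint ℂ) = ∞) (hi : f ∞ = ((0 : ℂ) : OnePoint ℂ)) :
    ∃ u, f = scaleMap u * inversionMap := by
  obtain ⟨u, hu⟩ := eq_scaleMap_of_fixes (Subgroup.mul_mem _ hf inversionMap_mem)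
    (by simp [hi]) (by simp [h0])
  exact ⟨u, by rw [← hu, mul_assoc, inversionMap_mul_self, mul_one]⟩

lemma exists_fixed_point {f : Equiv.Perm (OnePoint ℂ)} (hf : f ∈ moebiusGroup) : ∃ p, f p = p := by
  obtain ⟨a, b, c, d, h, rfl⟩ := exists_eq_moebiusMap hf
  by_cases hc : c = 0
  · exact ⟨∞, (moebiusMap_infty_eq_infty_iff h).2 hc⟩
  · obtain ⟨s, hs⟩ := IsAlgClosed.exists_pow_nat_eq ((d - a) ^ 2 + 4 * b * c) two_pos
    set z := (a - d + s) / (2 * c) with hz_def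
    have hz : c * z ^ 2 + (d - a) * z - b = 0 := by
      rw [hz_def]
      field_simp
      linear_combination hs
    refine ⟨z, (moebiusMap_coe_eq_coe_iff h).2 ⟨fun h0 => h ?_, by linear_combination -hz⟩⟩
    linear_combination (a - c * z) * h0 + c * hz

lemma exists_moebius_map_eq_infty (p : OnePoint ℂ) : ∃ g ∈ moebiusGroup, g p = ∞ := by
  cases p with
  | infty => exact ⟨1, Subgroup.one_mem _, rfl⟩
  | coe z => exact ⟨moebiusMap 0 1 1 (-z) (by simp), moebiusMap_mem _, by simp [moebiusMap_coe]⟩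

/-- A Möbius transformation of finite order that fixes `∞` has a finite fixed point. -/
lemma exists_coe_fixed_point {f : Equiv.Perm (OnePoint ℂ)} (hf : f ∈ moebiusGroup) (hi : f ∞ = ∞)
    {n : ℕ} (hn : n ≠ 0) (hpow : f ^ n = 1) : ∃ z : ℂ, f z = z := by
  obtain ⟨a, b, c, d, h, rfl⟩ := exists_eq_moebiusMap hf
  have hc := (moebiusMap_infty_eq_infty_iff h).1 hi
  subst hc
  have hd : d ≠ 0 := by
    rintro rfl
    simp at h
  -- Equal diagonal entries give a translation by `b / a`, which has finite order only if it is
  -- trivial.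
  by_cases had : a = d
  · subst had
    have hk : ∀ k : ℕ, (moebiusMap a b 0 a h ^ k) ((0 : ℂ) : OnePoint ℂ) = ((k * (b / a) : ℂ) : OnePoint ℂ) := by
      intro k
      induction k with
      | zero => simp
      | succ k ih =>
        rw [pow_succ', Equiv.Perm.mul_apply, ih, moebiusMap_coe, if_neg (by simpa using hd),
          OnePoint.coe_eq_coe]
        push_cast
        field_simp
        ring
    have hb : b = 0 := by
      have := hk n
      rw [hpow] at this
      simpa [hn, hd, eq_comm] using this
    exact ⟨0, by simp [moebiusMap_coe, hb, hd]⟩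
  · have had' : d - a ≠ 0 := sub_ne_zero.2 (Ne.symm had)
    refine ⟨b / (d - a), (moebiusMap_coe_eq_coe_iff h).2 ⟨by simpa using hd, ?_⟩⟩
    field_simp
    ring

lemma exists_conj_eq_scaleMap {f : Equiv.Perm (OnePoint ℂ)} (hf : f ∈ moebiusGroup)
    {n : ℕ} (hn : n ≠ 0) (hpow : f ^ n = 1) :
    ∃ g ∈ moebiusGroup, ∃ u, g * f * g⁻¹ = scaleMap u := by
  obtain ⟨p, hp⟩ := exists_fixed_point hf
  obtain ⟨g, hg, hgp⟩ := exists_moebius_map_eq_infty p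
  have hgp' : g⁻¹ ∞ = p := by
    rw [← hgp]
    exact Equiv.symm_apply_apply _ _
  have hf' : g * f * g⁻¹ ∈ moebiusGroup :=
    Subgroup.mul_mem _ (Subgroup.mul_mem _ hg hf) (Subgroup.inv_mem _ hg)
  have hi : (g * f * g⁻¹) ∞ = ∞ := by
    rw [Equiv.Perm.mul_apply, hgp', Equiv.Perm.mul_apply, hp, hgp]
  obtain ⟨z, hz⟩ := exists_coe_fixed_point hf' hi hn (by rw [conj_pow, hpow]; group)
  have hT : (1 : ℂ) * 1 - (-z) * 0 ≠ 0 := by simp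
  set T := moebiusMap 1 (-z) 0 1 hT with hT_def
  have hTi : T ∞ = ∞ := (moebiusMap_infty_eq_infty_iff hT).2 rfl
  have hTz : T z = ((0 : ℂ) : OnePoint ℂ) := by simp [T, moebiusMap_coe]
  have hTi' : T⁻¹ ∞ = ∞ := by
    conv_lhs => rw [← hTi]
    exact Equiv.symm_apply_apply _ _
  have hTz' : T⁻¹ ((0 : ℂ) : OnePoint ℂ) = z := by
    rw [← hTz]
    exact Equiv.symm_apply_apply _ _
  have hTm : T ∈ moebiusGroup := moebiusMap_mem _
  obtain ⟨u, hu⟩ := eq_scaleMap_of_fixes (f := T * (g * f * g⁻¹) * T⁻¹)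
    (Subgroup.mul_mem _ (Subgroup.mul_mem _ hTm hf') (Subgroup.inv_mem _ hTm))
    (by rw [Equiv.Perm.mul_apply, hTz', Equiv.Perm.mul_apply, hz, hTz])
    (by rw [Equiv.Perm.mul_apply, hTi', Equiv.Perm.mul_apply, hi, hTi])
  refine ⟨T * g, Subgroup.mul_mem _ hTm hg, u, ?_⟩
  rw [← hu]
  group

lemma scaleMap_fixes_iff {u : ℂˣ} (hu : u ≠ 1) (p : OnePoint ℂ) : scaleMap u p = p ↔ p ∈ orbitV := by
  induction p using OnePoint.rec with
  | infty => simp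
  | coe z =>
    rw [scaleMap_coe, OnePoint.coe_eq_coe, coe_mem_orbitV]
    have : (u : ℂ) ≠ 1 := fun h => hu (Units.ext h)
    refine ⟨fun h => ?_, fun h => by simp [h]⟩
    have h' : ((u : ℂ) - 1) * z = 0 := by linear_combination h
    exact (mul_eq_zero.1 h').resolve_left (sub_ne_zero.2 this)

/-- The normal form of a dihedral group of Möbius transformations. -/
lemma exists_conj_eq_standard {R S : Equiv.Perm (OnePoint ℂ)} (hR : R ∈ moebiusGroup)
    (hS : S ∈ moebiusGroup) {n : ℕ} (hn : 2 ≤ n) (hRn : orderOf R = n) (hSS : S * S = 1)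
    (hSR : S * R = R⁻¹ * S) (hSR' : S ∉ Subgroup.zpowers R) :
    ∃ g ∈ moebiusGroup, (∃ u : ℂˣ, orderOf u = n ∧ g * R * g⁻¹ = scaleMap u) ∧
      g * S * g⁻¹ = inversionMap := by
  obtain ⟨g, hg, u, hu⟩ := exists_conj_eq_scaleMap hR (n := n) (by lia) (by rw [← hRn, pow_orderOf_eq_one])
  have hun : orderOf u = n := by
    rw [← orderOf_injective _ scaleMap_injective, ← hu, ← hRn]
    exact orderOf_injective (MulAut.conj g).toMonoidHom (MulAut.conj g).injective R
  have hu1 : u ≠ 1 := by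
    rintro rfl
    rw [orderOf_one] at hun
    lia
  set s := g * S * g⁻¹ with hs
  have hsm : s ∈ moebiusGroup := Subgroup.mul_mem _ (Subgroup.mul_mem _ hg hS) (Subgroup.inv_mem _ hg)
  have hss : s * s = 1 := by
    rw [hs, show g * S * g⁻¹ * (g * S * g⁻¹) = g * (S * S) * g⁻¹ by group, hSS]
    group
  have hsu : scaleMap u * s * scaleMap u = s := by
    rw [hs, ← hu, show g * R * g⁻¹ * (g * S * g⁻¹) * (g * R * g⁻¹) = g * (R * (S * R)) * g⁻¹ by group, hSR]
    group
  have hinvol (p) : s (s p) = p := by rw [← Equiv.Perm.mul_apply, hss, Equiv.Perm.one_apply]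
  -- From `u s u = s`, the map `s` sends fixed points of the scaling `u` to fixed points, so it
  -- preserves `{0, ∞}`.
  have hV {p : OnePoint ℂ} (hp : p ∈ orbitV) : s p ∈ orbitV := by
    rw [← scaleMap_fixes_iff hu1] at hp ⊢
    have := Equiv.congr_fun hsu p
    simpa [hp] using this
  have h0 : s ((0 : ℂ) : OnePoint ℂ) = ((0 : ℂ) : OnePoint ℂ) ∨ s ((0 : ℂ) : OnePoint ℂ) = ∞ :=
    hV (coe_mem_orbitV.2 rfl)
  have hi : s ∞ = ((0 : ℂ) : OnePoint ℂ) ∨ s ∞ = ∞ := hV infty_mem_orbitV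
  rcases h0 with h0 | h0
  -- If `s` fixed both points it would be a scaling `v`. Then `u v u = v` and `s s = 1` give `u² =
  -- v² = 1`, so `u = -1` and `v = ±1`, and `S` would be a power of `R`.
  · exfalso
    have hi : s ∞ = ∞ := hi.resolve_left fun h => by
      have := s.injective (h.trans h0.symm)
      exact absurd this (by simp)
    obtain ⟨v, hv⟩ := eq_scaleMap_of_fixes hsm h0 hi
    rw [hv, ← map_mul, ← map_one scaleMap, scaleMap_injective.eq_iff] at hss
    rw [hv, ← map_mul, ← map_mul, scaleMap_injective.eq_iff] at hsu
    have huu : u * u = 1 := by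
      have : u * u * v = 1 * v := by
        rw [one_mul]
        conv_rhs => rw [← hsu]
        exact mul_right_comm _ _ _
      exact mul_right_cancel this
    have hsq {x : ℂˣ} (hx : x * x = 1) : x = 1 ∨ x = -1 := by
      have : (x : ℂ) * x = 1 := by simpa using congrArg Units.val hx
      rcases mul_self_eq_one_iff.1 this with h | h
      · exact .inl (Units.ext h)
      · exact .inr (Units.ext (by simpa using h))
    have hu' : u = -1 := (hsq huu).resolve_left hu1
    apply hSR'
    have hSg : S = g⁻¹ * scaleMap v * g := by rw [← hv, hs]; group
    rcases hsq hss with rfl | rfl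
    · rw [map_one] at hSg
      rw [hSg]
      simp
    · rw [← hu', ← hu] at hSg
      rw [hSg, show g⁻¹ * (g * R * g⁻¹) * g = R by group]
      exact Subgroup.mem_zpowers R
  · have hi : s ∞ = ((0 : ℂ) : OnePoint ℂ) := by rw [← h0, hinvol]
    obtain ⟨v, hv⟩ := eq_scaleMap_mul_inversionMap_of_swaps hsm h0 hi
    -- Conjugation by a scaling `τ` commutes with `u` and changes `v` to `τ² v`, so a square root of
    -- `v⁻¹` normalizes the reflection to the inversion.
    obtain ⟨t, ht⟩ := IsAlgClosed.exists_pow_nat_eq ((v⁻¹ : ℂˣ) : ℂ) two_pos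
    have ht0 : t ≠ 0 := by
      rintro rfl
      rw [zero_pow two_ne_zero] at ht
      exact (v⁻¹ : ℂˣ).ne_zero ht.symm
    set τ := Units.mk0 t ht0 with hτ
    have hτv : τ * v * τ = 1 := by
      apply Units.ext
      push_cast
      rw [mul_right_comm, hτ, Units.val_mk0, ← sq, ht, Units.inv_mul]
    refine ⟨scaleMap τ * g, Subgroup.mul_mem _ (scaleMap_mem _) hg, ⟨u, hun, ?_⟩, ?_⟩
    · rw [show scaleMap τ * g * R * (scaleMap τ * g)⁻¹ = scaleMap τ * (g * R * g⁻¹) * (scaleMap τ)⁻¹ by group,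
        hu, ← map_mul, ← map_inv, ← map_mul, mul_inv_cancel_comm]
    · rw [show scaleMap τ * g * S * (scaleMap τ * g)⁻¹ = scaleMap τ * (g * S * g⁻¹) * (scaleMap τ)⁻¹ by group,
        ← hs, hv, ← map_inv, mul_assoc, mul_assoc, inversionMap_mul_scaleMap, ← mul_assoc, ← mul_assoc,
        ← map_mul, ← map_mul, inv_inv, hτv, map_one, one_mul]

lemma moebiusStabilizer_image {g : Equiv.Perm (OnePoint ℂ)} (hg : g ∈ moebiusGroup)
    (α : Set (OnePoint ℂ)) :
    moebiusStabilizer (g '' α) = (moebiusStabilizer α).map (MulAut.conj g).toMonoidHom := by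
  ext f
  rw [Subgroup.mem_map]
  have key (f : Equiv.Perm (OnePoint ℂ)) :
      f ∈ moebiusStabilizer α → g * f * g⁻¹ ∈ moebiusStabilizer (g '' α) := by
    intro hf
    obtain ⟨h1, h2⟩ := mem_moebiusStabilizer.1 hf
    refine mem_moebiusStabilizer.2
      ⟨Subgroup.mul_mem _ (Subgroup.mul_mem _ hg h1) (Subgroup.inv_mem _ hg), fun p => ?_⟩
    obtain ⟨q, rfl⟩ := g.surjective p
    have hq : g⁻¹ (g q) = q := g.symm_apply_apply q
    simp only [Equiv.Perm.mul_apply, hq, g.injective.mem_set_image, h2]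
  constructor
  · intro hf
    obtain ⟨h1, h2⟩ := mem_moebiusStabilizer.1 hf
    refine ⟨g⁻¹ * f * g, mem_moebiusStabilizer.2
      ⟨Subgroup.mul_mem _ (Subgroup.mul_mem _ (Subgroup.inv_mem _ hg) h1) hg, fun p => ?_⟩, ?_⟩
    · have hp : g ((g⁻¹ * f * g) p) = f (g p) := g.apply_symm_apply _
      rw [← g.injective.mem_set_image (s := α), hp, h2, g.injective.mem_set_image]
    · simp [mul_assoc]
  · rintro ⟨f, hf, rfl⟩
    exact key f hf

/-- Every finite set with dihedral stabilizer is, up to a Möbius transformation, invariant under the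
standard dihedral group. -/
lemma exists_standard_position {n : ℕ} (hn : 2 ≤ n) {α : Set (OnePoint ℂ)}
    (h : Nonempty (moebiusStabilizer α ≃* DihedralGroup n)) :
    ∃ g : Equiv.Perm (OnePoint ℂ), stdDihedral n ≤ moebiusStabilizer (g '' α) ∧
      Nonempty (moebiusStabilizer (g '' α) ≃* DihedralGroup n) := by
  obtain ⟨e⟩ := h
  set R := e.symm (.r 1) with hR
  set S := e.symm (.sr 0) with hS
  have hord : orderOf (R : Equiv.Perm (OnePoint ℂ)) = n := by
    rw [Subgroup.orderOf_coe, hR, MulEquiv.orderOf_eq, DihedralGroup.orderOf_r_one]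
  have hSS : S * S = 1 := by rw [hS, ← map_mul, DihedralGroup.sr_mul_self, map_one]
  have hSR : S * R = R⁻¹ * S := by
    rw [hS, hR, ← map_mul, ← map_inv, ← map_mul]
    simp
  have hSR' : (S : Equiv.Perm (OnePoint ℂ)) ∉ Subgroup.zpowers (R : Equiv.Perm (OnePoint ℂ)) := by
    rintro ⟨k, hk⟩
    have hk : R ^ k = S := Subtype.ext (by simpa using hk)
    rw [hR, ← map_zpow, hS, e.symm.injective.eq_iff, DihedralGroup.r_one_zpow] at hk
    cases hk
  obtain ⟨g, hg, ⟨u, hu, hgR⟩, hgS⟩ := exists_conj_eq_standard (mem_moebiusStabilizer.1 R.2).1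
    (mem_moebiusStabilizer.1 S.2).1 hn hord (congrArg Subtype.val hSS) (congrArg Subtype.val hSR) hSR'
  have hconj := moebiusStabilizer_image hg α
  refine ⟨g, ?_, ?_⟩
  · have hR' : scaleMap u ∈ moebiusStabilizer (g '' α) := by
      rw [hconj, ← hgR]
      exact Subgroup.mem_map_of_mem _ R.2
    have hS' : inversionMap ∈ moebiusStabilizer (g '' α) := by
      rw [hconj, ← hgS]
      exact Subgroup.mem_map_of_mem _ S.2
    have : NeZero n := ⟨by lia⟩
    have hprim : IsPrimitiveRoot (u : ℂ) n :=
      IsPrimitiveRoot.coe_units_iff.2 (hu ▸ IsPrimitiveRoot.orderOf u)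
    -- The scalar `u` is only some primitive `n`-th root of unity; a power of it is `exp (2 π i /
    -- n)`.
    obtain ⟨i, -, hi⟩ := hprim.eq_pow_of_pow_eq_one
      (isPrimitiveRoot_circlePoint (n := n) (by lia)).pow_eq_one
    rw [stdDihedral, Subgroup.closure_le]
    rintro _ (rfl | rfl)
    · have : circleUnit (1 / n) = u ^ i := Units.ext (by simpa using hi.symm)
      rw [rotationMap_eq, this, map_pow]
      exact Subgroup.pow_mem _ hR' _
    · exact hS'
  · rw [hconj]
    exact ⟨(Subgroup.equivMapOfInjective _ _ (MulAut.conj g).injective).symm.trans e⟩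

/-! ### Explicit orbits and standard unions -/

/-- The `n`-th powers of the points of `explicitSet n k`. -/
def explicitPowers (k : ℕ) : Set ℂ :=
  {w | ∃ l ∈ Finset.Icc 1 k, w = circlePoint (l / (8 * k ^ 2)) ∨ w = circlePoint (-(l / (8 * k ^ 2)))}

lemma circlePoint_explicit_pow {n : ℕ} (hn : n ≠ 0) (l k : ℕ) :
    circlePoint (l / (8 * k ^ 2 * n)) ^ n = circlePoint (l / (8 * k ^ 2)) := by
  rw [← circlePoint_nat_mul]
  congr 1
  have : (n : ℝ) ≠ 0 := by exact_mod_cast hn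
  rw [← div_div, mul_div_cancel₀ _ this]

lemma coe_mem_explicitSet {n : ℕ} (hn : n ≠ 0) {k : ℕ} {z : ℂ} :
    (z : OnePoint ℂ) ∈ explicitSet n k ↔ z ^ n ∈ explicitPowers k := by
  simp only [explicitSet, Set.mem_iUnion, coe_mem_orbitC hn (circlePoint_ne_zero _),
    circlePoint_explicit_pow hn, ← circlePoint_neg, explicitPowers, Set.mem_ofPred_eq, exists_prop]

@[simp] lemma infty_notMem_explicitSet {n k : ℕ} : ∞ ∉ explicitSet n k := by
  simp [explicitSet]

/-- From `l ≤ k ≤ k²`: every angle is positive and at most an eighth of a turn. -/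
lemma explicit_angle_bounds {k l : ℕ} (hl : l ∈ Finset.Icc 1 k) :
    0 < (l : ℝ) / (8 * k ^ 2) ∧ (l : ℝ) / (8 * k ^ 2) ≤ 1 / 8 := by
  obtain ⟨h1, h2⟩ := Finset.mem_Icc.1 hl
  have h1' : (1 : ℝ) ≤ l := by exact_mod_cast h1
  have h2' : (l : ℝ) ≤ k := by exact_mod_cast h2
  have hk : (1 : ℝ) ≤ k := h1'.trans h2'
  refine ⟨by positivity, ?_⟩
  rw [div_le_div_iff₀ (by positivity) (by norm_num)]
  nlinarith

/-- An eighth of a turn is `π / 4`, less than `π / 3`. -/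
lemma half_lt_re_of_mem_explicitPowers {k : ℕ} {w : ℂ} (hw : w ∈ explicitPowers k) :
    1 / 2 < w.re := by
  obtain ⟨l, hl, hw⟩ := hw
  obtain ⟨h1, h2⟩ := explicit_angle_bounds hl
  set θ : ℝ := l / (8 * k ^ 2) with hθ
  have key : w.re = Real.cos (2 * Real.pi * θ) := by
    rcases hw with rfl | rfl
    · rw [circlePoint_re]
    · rw [circlePoint_re, mul_neg, Real.cos_neg]
  rw [key, ← Real.cos_pi_div_three]
  have hpi := Real.pi_pos
  exact Real.cos_lt_cos_of_nonneg_of_le_pi (by positivity) (by linarith) (by nlinarith)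

lemma norm_of_mem_explicitPowers {k : ℕ} {w : ℂ} (hw : w ∈ explicitPowers k) : ‖w‖ = 1 := by
  obtain ⟨l, -, rfl | rfl⟩ := hw <;> simp

lemma ne_one_of_mem_explicitPowers {k : ℕ} {w : ℂ} (hw : w ∈ explicitPowers k) : w ≠ 1 := by
  obtain ⟨l, hl, hw⟩ := hw
  obtain ⟨h1, h2⟩ := explicit_angle_bounds hl
  have key {j : ℤ} (h3 : (0 : ℝ) < j) (h4 : (j : ℝ) ≤ 1 / 8) : False := by
    have h3' : 0 < j := by exact_mod_cast h3
    have : (1 : ℝ) ≤ j := by exact_mod_cast h3'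
    linarith
  rcases hw with rfl | rfl <;> rw [← circlePoint_zero, Ne, circlePoint_eq_iff]
  · rintro ⟨j, hj⟩
    exact key (j := j) (by linarith) (by linarith)
  · rintro ⟨j, hj⟩
    exact key (j := -j) (by push_cast; linarith) (by push_cast; linarith)

lemma ne_neg_one_of_mem_explicitPowers {k : ℕ} {w : ℂ} (hw : w ∈ explicitPowers k) : w ≠ -1 := by
  rintro rfl
  have := half_lt_re_of_mem_explicitPowers hw
  norm_num at this

lemma inv_mem_explicitPowers {k : ℕ} {w : ℂ} (hw : w ∈ explicitPowers k) : w⁻¹ ∈ explicitPowers k := by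
  obtain ⟨l, hl, rfl | rfl⟩ := hw
  · exact ⟨l, hl, .inr (circlePoint_neg _).symm⟩
  · exact ⟨l, hl, .inl (by rw [circlePoint_neg, inv_inv])⟩

/-- Sums and differences of two such angles are less than a full turn, so the integer ambiguity is
zero; and a sum of two positive angles is not zero. Hence the `k` orbits are distinct. -/
lemma circlePoint_explicit_injOn {k l m : ℕ} (hl : l ∈ Finset.Icc 1 k) (hm : m ∈ Finset.Icc 1 k)
    (h : circlePoint (l / (8 * k ^ 2)) = circlePoint (m / (8 * k ^ 2)) ∨
      circlePoint (l / (8 * k ^ 2)) = (circlePoint (m / (8 * k ^ 2)))⁻¹) : l = m := by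
  obtain ⟨h1, h2⟩ := explicit_angle_bounds hl
  obtain ⟨h3, h4⟩ := explicit_angle_bounds hm
  have hk : (8 * (k : ℝ) ^ 2) ≠ 0 := by
    rintro h0
    rw [h0, div_zero] at h1
    exact lt_irrefl _ h1
  have key {j : ℤ} (h5 : (-1 : ℝ) < j) (h6 : (j : ℝ) < 1) : j = 0 := by
    have h5' : -1 < j := by exact_mod_cast h5
    have h6' : j < 1 := by exact_mod_cast h6
    lia
  rcases h with h | h
  · obtain ⟨j, hj⟩ := circlePoint_eq_iff.1 h
    obtain rfl := key (j := j) (by linarith) (by linarith)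
    have : (l : ℝ) / (8 * k ^ 2) = m / (8 * k ^ 2) := by simpa using hj
    rw [div_left_inj' hk] at this
    exact_mod_cast this
  · rw [← circlePoint_neg] at h
    obtain ⟨j, hj⟩ := circlePoint_eq_iff.1 h
    obtain rfl := key (j := j) (by linarith) (by linarith)
    norm_num at hj
    linarith

/-- The union of the special orbits selected by the three propositions and of `explicitSet n k`. -/
def stdUnion (n : ℕ) (PV PA PB : Prop) (k : ℕ) : Set (OnePoint ℂ) :=
  {p | (PV ∧ p ∈ orbitV) ∨ (PA ∧ p ∈ orbitA n) ∨ (PB ∧ p ∈ orbitB n) ∨ p ∈ explicitSet n k}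

section stdUnion

variable {n : ℕ} {PV PA PB : Prop} {k : ℕ}

lemma coe_mem_stdUnion (hn : n ≠ 0) {z : ℂ} : (z : OnePoint ℂ) ∈ stdUnion n PV PA PB k ↔
    (PV ∧ z = 0) ∨ (PA ∧ z ^ n = 1) ∨ (PB ∧ z ^ n = -1) ∨ z ^ n ∈ explicitPowers k := by
  simp only [stdUnion, Set.mem_ofPred_eq, coe_mem_orbitV, coe_mem_orbitA hn, coe_mem_orbitB hn,
    coe_mem_explicitSet hn]

lemma infty_mem_stdUnion : ∞ ∈ stdUnion n PV PA PB k ↔ PV := by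
  simp [stdUnion]

lemma finite_explicitSet (hn : n ≠ 0) : (explicitSet n k).Finite :=
  (Finset.finite_toSet _).biUnion fun _ _ => finite_orbitC hn (circlePoint_ne_zero _)

lemma finite_stdUnion (hn : n ≠ 0) : (stdUnion n PV PA PB k).Finite := by
  have hA : (orbitA n).Finite := Set.finite_of_ncard_ne_zero (by rwa [ncard_orbitA hn])
  have hB : (orbitB n).Finite := Set.finite_of_ncard_ne_zero (by rwa [ncard_orbitB hn])
  refine (((finite_orbitV.union hA).union hB).union (finite_explicitSet (k := k) hn)).subset ?_
  intro p hp
  simp only [stdUnion, Set.mem_ofPred_eq] at hp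
  simp only [Set.mem_union]
  tauto

lemma stdUnion_invariant (hn : n ≠ 0) :
    stdDihedral n ≤ moebiusStabilizer (stdUnion n PV PA PB k) := by
  apply stdDihedral_le_moebiusStabilizer hn
  · intro u hu p hp
    have hu' : (u : ℂ) ^ n = 1 := by simpa using congrArg Units.val hu
    induction p using OnePoint.rec with
    | infty => rwa [scaleMap_infty]
    | coe z =>
      rw [coe_mem_stdUnion hn] at hp
      rw [scaleMap_coe, coe_mem_stdUnion hn, mul_pow, hu', one_mul]
      simpa using hp
  · intro p hp
    induction p using OnePoint.rec with
    | infty =>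
      rw [infty_mem_stdUnion] at hp
      rw [inversionMap_infty, coe_mem_stdUnion hn]
      exact .inl ⟨hp, rfl⟩
    | coe z =>
      rw [coe_mem_stdUnion hn] at hp
      by_cases hz : z = 0
      · subst hz
        rw [inversionMap_zero, infty_mem_stdUnion]
        rcases hp with h | h | h | h
        · exact h.1
        · simp [hn] at h
        · simp [hn] at h
        · have := norm_of_mem_explicitPowers h
          simp [hn] at this
      · rw [inversionMap_coe hz, coe_mem_stdUnion hn, inv_pow]
        rcases hp with h | h | h | h
        · exact absurd h.2 hz
        · exact .inr (.inl ⟨h.1, by rw [h.2, inv_one]⟩)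
        · exact .inr (.inr (.inl ⟨h.1, by rw [h.2]; norm_num⟩))
        · exact .inr (.inr (.inr (inv_mem_explicitPowers h)))

lemma orbitV_subset_stdUnion_iff (hn : n ≠ 0) : orbitV ⊆ stdUnion n PV PA PB k ↔ PV := by
  rw [orbitV_subset_iff_infty (stdUnion_invariant hn), infty_mem_stdUnion]

lemma orbitA_subset_stdUnion_iff (hn : n ≠ 0) : orbitA n ⊆ stdUnion n PV PA PB k ↔ PA := by
  rw [orbitA_subset_iff hn (stdUnion_invariant hn) (one_pow n), coe_mem_stdUnion hn, one_pow]
  have h : (1 : ℂ) ∉ explicitPowers k := fun h => ne_one_of_mem_explicitPowers h rfl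
  have h1 : (1 : ℂ) ≠ -1 := by norm_num
  simp [h, h1]

lemma orbitB_subset_stdUnion_iff (hn : n ≠ 0) : orbitB n ⊆ stdUnion n PV PA PB k ↔ PB := by
  rw [orbitB_subset_iff hn (stdUnion_invariant hn) (circlePoint_odd_pow hn), coe_mem_stdUnion hn,
    circlePoint_odd_pow hn]
  have h : (-1 : ℂ) ∉ explicitPowers k := fun h => ne_neg_one_of_mem_explicitPowers h rfl
  have h1 : (-1 : ℂ) ≠ 1 := by norm_num
  simp [h, h1, circlePoint_ne_zero]

lemma ncard_typeC_stdUnion (hn : n ≠ 0) :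
    {O : Set (OnePoint ℂ) | O ∈ typeC n ∧ O ⊆ stdUnion n PV PA PB k}.ncard = k := by
  have h : {O : Set (OnePoint ℂ) | O ∈ typeC n ∧ O ⊆ stdUnion n PV PA PB k} =
      (fun l : ℕ => orbitC n (circlePoint (l / (8 * k ^ 2 * n)))) '' (Finset.Icc 1 k : Finset ℕ) := by
    ext O
    simp only [Set.mem_ofPred_eq, mem_typeC_iff hn, Set.mem_image, Finset.mem_coe]
    constructor
    · rintro ⟨⟨z, hz, h1, h2, rfl⟩, hO⟩
      rw [orbitC_subset_iff hn (stdUnion_invariant hn) hz, coe_mem_stdUnion hn] at hO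
      obtain ⟨l, hl, h⟩ : z ^ n ∈ explicitPowers k := by tauto
      refine ⟨l, hl, ?_⟩
      rw [eq_comm, orbitC_eq_orbitC_iff hn (circlePoint_ne_zero _) hz, circlePoint_explicit_pow hn,
        ← circlePoint_neg]
      exact h
    · rintro ⟨l, hl, rfl⟩
      have hmem : circlePoint (l / (8 * k ^ 2)) ∈ explicitPowers k := ⟨l, hl, .inl rfl⟩
      refine ⟨⟨_, circlePoint_ne_zero _, ?_, ?_, rfl⟩, ?_⟩
      · rw [circlePoint_explicit_pow hn]
        exact ne_one_of_mem_explicitPowers hmem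
      · rw [circlePoint_explicit_pow hn]
        exact ne_neg_one_of_mem_explicitPowers hmem
      · rw [orbitC_subset_iff hn (stdUnion_invariant hn) (circlePoint_ne_zero _), coe_mem_stdUnion hn,
          circlePoint_explicit_pow hn]
        exact .inr (.inr (.inr hmem))
  rw [h, Set.InjOn.ncard_image, Set.ncard_coe_finset, Nat.card_Icc, Nat.add_sub_cancel]
  intro l hl m hm hlm
  simp only at hlm
  rw [orbitC_eq_orbitC_iff hn (circlePoint_ne_zero _) (circlePoint_ne_zero _),
    circlePoint_explicit_pow hn, circlePoint_explicit_pow hn] at hlm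
  exact circlePoint_explicit_injOn hl hm hlm

lemma dihedralIndex_stdUnion [Decidable PV] [Decidable PA] [Decidable PB]
    (hn : n ≠ 0) : dihedralIndex n (stdUnion n PV PA PB k) =
    (if PV then 1 else 0, (if PA then 1 else 0) + (if PB then 1 else 0), k) := by
  classical
  refine Prod.ext ?_ (Prod.ext ?_ (ncard_typeC_stdUnion hn))
  · rw [dihedralIndex_fst]
    exact if_congr (orbitV_subset_stdUnion_iff hn) rfl rfl
  · rw [dihedralIndex_snd_fst hn]
    exact congrArg₂ _ (if_congr (orbitA_subset_stdUnion_iff hn) rfl rfl)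
      (if_congr (orbitB_subset_stdUnion_iff hn) rfl rfl)

/-- The only summand that may have negative real part is `-1`, and `x`, `y` together outweigh it. -/
lemma sum_ne_zero_of_re {F : Finset ℂ} {x y : ℂ} (hx : x ∈ F) (hy : y ∈ F) (hxy : x ≠ y)
    (hx' : 1 / 2 < x.re) (hy' : 1 / 2 < y.re) (hF : ∀ w ∈ F, w = -1 ∨ 0 ≤ w.re) :
    ∑ w ∈ F, w ≠ 0 := by
  intro h
  have h0 : ∑ w ∈ F, w.re = 0 := by rw [← Complex.re_sum, h, Complex.zero_re]
  have h1 : x.re + y.re ≤ ∑ w ∈ F, (w.re + if w = -1 then 1 else 0) := by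
    refine le_trans ?_ (Finset.sum_le_sum_of_subset_of_nonneg (s := {x, y}) ?_ ?_)
    · rw [Finset.sum_pair hxy]
      have : ∀ w : ℂ, w.re ≤ w.re + if w = -1 then 1 else 0 := fun w => by split_ifs <;> linarith
      linarith [this x, this y]
    · intro w hw
      rcases Finset.mem_insert.1 hw with rfl | hw
      · exact hx
      · rwa [Finset.mem_singleton.1 hw]
    · intro w hw _
      rcases hF w hw with rfl | h
      · simp
      · split_ifs <;> linarith
  have h2 : ∑ w ∈ F, (if w = -1 then (1 : ℝ) else 0) ≤ 1 := by
    rw [Finset.sum_ite_eq']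
    split_ifs <;> norm_num
  rw [Finset.sum_add_distrib, h0] at h1
  linarith

lemma norm_eq_one_of_coe_mem_stdUnion (hn : n ≠ 0) {z : ℂ}
    (hz : (z : OnePoint ℂ) ∈ stdUnion n False PA PB k) : ‖z‖ = 1 := by
  rw [coe_mem_stdUnion hn] at hz
  rw [← pow_eq_one_iff_of_nonneg (norm_nonneg z) hn, ← norm_pow]
  rcases hz with h | h | h | h
  · exact h.1.elim
  · rw [h.2, norm_one]
  · rw [h.2, norm_neg, norm_one]
  · exact norm_of_mem_explicitPowers h

lemma exists_pow_eq_and_coe_mem_stdUnion_iff (hn : n ≠ 0) {w : ℂ} :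
    (∃ z : ℂ, (z : OnePoint ℂ) ∈ stdUnion n False PA PB k ∧ z ^ n = w) ↔
      (PA ∧ w = 1) ∨ (PB ∧ w = -1) ∨ w ∈ explicitPowers k := by
  constructor
  · rintro ⟨z, hz, rfl⟩
    rw [coe_mem_stdUnion hn] at hz
    simpa using hz
  · intro h
    obtain ⟨z, rfl⟩ := IsAlgClosed.exists_pow_nat_eq w (Nat.pos_of_ne_zero hn)
    exact ⟨z, (coe_mem_stdUnion hn).2 (.inr h), rfl⟩

lemma finite_explicitPowers (k : ℕ) : (explicitPowers k).Finite := by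
  have : explicitPowers k ⊆ (fun l : ℕ => circlePoint (l / (8 * k ^ 2))) '' (Finset.Icc 1 k : Finset ℕ) ∪
      (fun l : ℕ => circlePoint (-(l / (8 * k ^ 2)))) '' (Finset.Icc 1 k : Finset ℕ) := by
    rintro w ⟨l, hl, rfl | rfl⟩
    · exact .inl ⟨l, hl, rfl⟩
    · exact .inr ⟨l, hl, rfl⟩
  exact (((Finset.finite_toSet _).image _).union ((Finset.finite_toSet _).image _)).subset this

/-- For `k ≥ 1` the conjugate pair given by `l = 1` outweighs a possible `-1` from `B_n`. For `k =
0` and only `A_n` present, the sum is `1`. -/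
lemma finsum_powers_ne_zero (hk : 1 ≤ k ∨ (k = 0 ∧ PA ∧ ¬ PB)) :
    ∑ᶠ w ∈ {w : ℂ | (PA ∧ w = 1) ∨ (PB ∧ w = -1) ∨ w ∈ explicitPowers k}, w ≠ 0 := by
  rcases hk with hk | ⟨rfl, hA, hB⟩
  · have hfin : {w : ℂ | (PA ∧ w = 1) ∨ (PB ∧ w = -1) ∨ w ∈ explicitPowers k}.Finite := by
      refine ((finite_explicitPowers k).union (Set.toFinite {(1 : ℂ), -1})).subset ?_
      rintro w (h | h | h)
      · exact .inr (.inl h.2)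
      · exact .inr (.inr h.2)
      · exact .inl h
    have h1 : 1 ∈ Finset.Icc 1 k := Finset.mem_Icc.2 ⟨le_rfl, hk⟩
    have hx : circlePoint ((1 : ℕ) / (8 * k ^ 2)) ∈ explicitPowers k := ⟨1, h1, .inl rfl⟩
    have hy : circlePoint (-((1 : ℕ) / (8 * k ^ 2))) ∈ explicitPowers k := ⟨1, h1, .inr rfl⟩
    rw [finsum_mem_eq_finite_toFinset_sum _ hfin]
    refine sum_ne_zero_of_re (hfin.mem_toFinset.2 (.inr (.inr hx)))
      (hfin.mem_toFinset.2 (.inr (.inr hy))) ?_ (half_lt_re_of_mem_explicitPowers hx)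
      (half_lt_re_of_mem_explicitPowers hy) ?_
    · intro h
      obtain ⟨b1, b2⟩ := explicit_angle_bounds h1
      obtain ⟨j, hj⟩ := circlePoint_eq_iff.1 h
      have h3 : (0 : ℝ) < j := by linarith
      have h3' : 0 < j := by exact_mod_cast h3
      have : (1 : ℝ) ≤ j := by exact_mod_cast h3'
      linarith
    · intro w hw
      rcases hfin.mem_toFinset.1 hw with h | h | h
      · exact .inr (by simp [h.2])
      · exact .inl h.2
      · exact .inr (by linarith [half_lt_re_of_mem_explicitPowers h])
  · have : {w : ℂ | (PA ∧ w = 1) ∨ (PB ∧ w = -1) ∨ w ∈ explicitPowers 0} = {1} := by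
      ext w
      simp [hA, hB, explicitPowers]
    rw [this, finsum_mem_singleton]
    exact one_ne_zero

/-- The stabilizer of a standard union of orbits is the dihedral group, if sufficiently many points
lie on the unit circle. -/
lemma moebiusStabilizer_stdUnion [Decidable PV] [Decidable PA] [Decidable PB]
    (hn : 2 ≤ n) (hk : 1 ≤ k ∨ (k = 0 ∧ PA ∧ ¬ PB))
    (hcard : 3 + 2 * (if PV then 1 else 0) ≤
      n * ((if PA then 1 else 0) + (if PB then 1 else 0) + 2 * k)) :
    moebiusStabilizer (stdUnion n PV PA PB k) = stdDihedral n := by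
  have hn0 : n ≠ 0 := by lia
  have hT : {p | PV ∧ p ∈ orbitV} ⊆ orbitV := fun p hp => hp.2
  refine moebiusStabilizer_eq_of_sum_ne_zero hn (stdUnion_invariant hn0)
    (S := stdUnion n False PA PB k) (T := {p | PV ∧ p ∈ orbitV}) ?_ ?_ (finite_orbitV.subset hT) hT ?_
    (fun w => (exists_pow_eq_and_coe_mem_stdUnion_iff hn0).symm) (finsum_powers_ne_zero hk)
  · ext p
    simp only [stdUnion, Set.mem_union, Set.mem_ofPred_eq]
    tauto
  · intro p hp
    induction p using OnePoint.rec with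
    | infty => exact (infty_mem_stdUnion.1 hp).elim
    | coe z => exact ⟨z, norm_eq_one_of_coe_mem_stdUnion hn0 hp, rfl⟩
  · rw [ncard_eq_of_invariant hn0 (finite_stdUnion hn0) (stdUnion_invariant hn0),
      dihedralIndex_stdUnion hn0]
    have : {p | PV ∧ p ∈ orbitV}.ncard = 2 * (if PV then 1 else 0) := by
      by_cases h : PV
      · simpa [h] using ncard_orbitV
      · simp [h]
    rw [this]
    simpa using hcard

end stdUnion

/-! ### The triangular bipyramid -/

/-- The set `{0, ∞}` is preserved by the stabilizer of the vertices of the triangular bipyramid. -/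
lemma apply_zero_mem_orbitV_bipyramid {f : Equiv.Perm (OnePoint ℂ)}
    (hf : f ∈ moebiusStabilizer (stdUnion 3 True True False 0)) :
    f ((0 : ℂ) : OnePoint ℂ) ∈ orbitV := by
  have h3 : (3 : ℕ) ≠ 0 := by norm_num
  have hmem (z : ℂ) : (z : OnePoint ℂ) ∈ stdUnion 3 True True False 0 ↔ z = 0 ∨ z ^ 3 = 1 := by
    rw [coe_mem_stdUnion h3]
    simp [explicitPowers]
  have h0 : f ((0 : ℂ) : OnePoint ℂ) ∈ stdUnion 3 True True False 0 :=
    ((mem_moebiusStabilizer.1 hf).2 _).2 ((hmem 0).2 (.inl rfl))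
  generalize hq : f ((0 : ℂ) : OnePoint ℂ) = q at h0
  induction q using OnePoint.rec with
  | infty => simp
  | coe z =>
    rcases (hmem z).1 h0 with rfl | hz
    · exact coe_mem_orbitV.2 rfl
    exfalso
    have hz0 : z ≠ 0 := by
      rintro rfl
      simp at hz
    -- After a rotation the symmetry may be assumed to send `0` to `1`.
    have hrot : scaleMap (Units.mk0 z hz0)⁻¹ ∈ stdDihedral 3 :=
      (mem_stdDihedral_iff h3).2 ⟨_, by ext; simp [hz], .inl rfl⟩
    have hg := Subgroup.mul_mem _ (stdUnion_invariant h3 hrot) hf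
    set g := scaleMap (Units.mk0 z hz0)⁻¹ * f with hg_def
    have hg0 : g ((0 : ℂ) : OnePoint ℂ) = ((1 : ℂ) : OnePoint ℂ) := by
      rw [hg_def, Equiv.Perm.mul_apply, hq, scaleMap_coe, Units.val_inv_eq_inv_val, Units.val_mk0,
        inv_mul_cancel₀ hz0]
    clear_value g
    obtain ⟨hgm, hgα⟩ := mem_moebiusStabilizer.1 hg
    obtain ⟨a, b, c, d, h, rfl⟩ := exists_eq_moebiusMap hgm
    obtain ⟨hd, hbd⟩ := (moebiusMap_coe_eq_coe_iff h).1 hg0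
    have hbd : b = d := by simpa using hbd
    have hd : d ≠ 0 := by simpa using hd
    subst hbd
    have hquad {x y : ℂ} (h1 : x ^ 3 = y ^ 3) (h2 : x ≠ y) : x ^ 2 + x * y + y ^ 2 = 0 := by
      apply mul_left_cancel₀ (sub_ne_zero.2 h2)
      linear_combination h1
    -- All points other than `0` go to `0`, `∞` or a primitive cube root of unity. In homogeneous
    -- coordinates these are the zeros of `X Y (X² + X Y + Y²)`.
    have hinf : a * c * (a ^ 2 + a * c + c ^ 2) = 0 := by
      have h1 := (hgα ∞).2 (infty_mem_stdUnion.2 trivial)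
      have h2 : moebiusMap a b c b h ∞ ≠ ((1 : ℂ) : OnePoint ℂ) := by
        rw [← hg0]
        exact (Equiv.injective _).ne (by simp)
      rw [moebiusMap_infty] at h1 h2
      by_cases hc : c = 0
      · simp [hc]
      · rw [if_neg hc, hmem] at h1
        rw [if_neg hc, Ne, OnePoint.coe_eq_coe, div_eq_one_iff_eq hc] at h2
        rcases h1 with h1 | h1
        · have : a = 0 := by simpa [hc] using h1
          simp [this]
        · rw [div_pow, div_eq_one_iff_eq (pow_ne_zero _ hc)] at h1
          rw [hquad h1 h2, mul_zero]
    have hroot {w : ℂ} (hw : w ^ 3 = 1) : (a * w + b) * (c * w + b) *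
        ((a * w + b) ^ 2 + (a * w + b) * (c * w + b) + (c * w + b) ^ 2) = 0 := by
      have hw0 : w ≠ 0 := by
        rintro rfl
        simp at hw
      have h1 := (hgα w).2 ((hmem w).2 (.inr hw))
      have h2 : moebiusMap a b c b h w ≠ ((1 : ℂ) : OnePoint ℂ) := by
        rw [← hg0]
        exact (Equiv.injective _).ne (by simpa using hw0)
      rw [moebiusMap_coe] at h1 h2
      by_cases hc : c * w + b = 0
      · simp [hc]
      · rw [if_neg hc, hmem] at h1
        rw [if_neg hc, Ne, OnePoint.coe_eq_coe, div_eq_one_iff_eq hc] at h2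
        rcases h1 with h1 | h1
        · have : a * w + b = 0 := by simpa [hc] using h1
          simp [this]
        · rw [div_pow, div_eq_one_iff_eq (pow_ne_zero _ hc)] at h1
          rw [hquad h1 h2, mul_zero]
    have hω := isPrimitiveRoot_circlePoint h3
    set ω := circlePoint (1 / (3 : ℕ)) with hω_def
    -- Reducing the quartic in `w` by `w ^ 3 = 1` and the condition at `∞` leaves a quadratic
    -- vanishing at all three cube roots of unity. Its coefficients force `a + c = 0` and `a c = 0`,
    -- against the determinant.
    have hpoly {w : ℂ} (hw : w ^ 3 = 1) : ((4 * (a + c) ^ 2 + 2 * (a * c)) * b ^ 2) * w ^ 2 +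
        (6 * (a + c) * b ^ 3) * w + (3 * b ^ 4 + (2 * (a * c) * (a + c) + (a + c) ^ 3) * b) = 0 := by
      linear_combination hroot hw - w * hinf
        - ((2 * (a * c) * (a + c) + (a + c) ^ 3) * b + w * (a * c * (a ^ 2 + a * c + c ^ 2))) * hw
    obtain ⟨e2, e1, -⟩ := quadratic_eq_zero_of_three_roots
      (hω.ne_one (by norm_num)).symm
      (fun h => hω.pow_ne_one_of_pos_of_lt two_ne_zero (by norm_num) h.symm)
      (fun h => hω.ne_one (by norm_num) (by
        apply mul_left_cancel₀ (hω.ne_zero h3)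
        linear_combination -h))
      (hpoly (w := 1) (by norm_num)) (hpoly (w := ω) hω.pow_eq_one)
      (hpoly (w := ω ^ 2) (by rw [← pow_mul, mul_comm, pow_mul, hω.pow_eq_one, one_pow]))
    have hs : a + c = 0 := by simpa [hd] using e1
    have hp : a * c = 0 := by simpa [hd, hs] using e2
    apply h
    rcases mul_eq_zero.1 hp with ha | hc
    · rw [ha, zero_add] at hs
      rw [ha, hs]
      ring
    · rw [hc, add_zero] at hs
      rw [hc, hs]
      ring

lemma moebiusStabilizer_bipyramid :
    moebiusStabilizer (stdUnion 3 True True False 0) = stdDihedral 3 := by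
  have h3 : (3 : ℕ) ≠ 0 := by norm_num
  have hmem (z : ℂ) : (z : OnePoint ℂ) ∈ stdUnion 3 True True False 0 ↔ z = 0 ∨ z ^ 3 = 1 := by
    rw [coe_mem_stdUnion h3]
    simp [explicitPowers]
  refine le_antisymm (fun f hf => ?_) (stdUnion_invariant h3)
  have hinv := stdUnion_invariant (PV := True) (PA := True) (PB := False) (k := 0) h3
    (inversionMap_mem_stdDihedral 3)
  have hfm := (mem_moebiusStabilizer.1 hf).1
  have h0 := apply_zero_mem_orbitV_bipyramid hf
  have hi := apply_zero_mem_orbitV_bipyramid (Subgroup.mul_mem _ hf hinv)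
  rw [Equiv.Perm.mul_apply, inversionMap_zero] at hi
  have hne : f ((0 : ℂ) : OnePoint ℂ) ≠ f ∞ := f.injective.ne (by simp)
  obtain ⟨u, hu⟩ : ∃ u, f = scaleMap u ∨ f = scaleMap u * inversionMap := by
    rcases h0 with h0 | h0 <;> rcases hi with hi | hi
    · exact absurd (h0.trans hi.symm) hne
    · obtain ⟨u, hu⟩ := eq_scaleMap_of_fixes hfm h0 hi
      exact ⟨u, .inl hu⟩
    · obtain ⟨u, hu⟩ := eq_scaleMap_mul_inversionMap_of_swaps hfm h0 hi
      exact ⟨u, .inr hu⟩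
    · exact absurd (h0.trans hi.symm) hne
  refine (mem_stdDihedral_iff h3).2 ⟨u, ?_, hu⟩
  have huα : scaleMap u ∈ moebiusStabilizer (stdUnion 3 True True False 0) := by
    rcases hu with rfl | rfl
    · exact hf
    · exact (Subgroup.mul_mem_cancel_right _ hinv).1 hf
  have h1 := ((mem_moebiusStabilizer.1 huα).2 ((1 : ℂ) : OnePoint ℂ)).2 ((hmem 1).2 (.inr (one_pow 3)))
  rw [scaleMap_coe, mul_one, hmem] at h1
  exact Units.ext (by simpa using h1)

/-! ### Sets without generic orbits -/

lemma eq_stdUnion_of_index_zero {n : ℕ} (hn : n ≠ 0) {α : Set (OnePoint ℂ)} (hfin : α.Finite)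
    (hα : stdDihedral n ≤ moebiusStabilizer α) (hk : (dihedralIndex n α).2.2 = 0) :
    α = stdUnion n (orbitV ⊆ α) (orbitA n ⊆ α) (orbitB n ⊆ α) 0 := by
  -- Finiteness of `α` is essential: `ncard` would also be `0` for an infinite family.
  have hC : {O : Set (OnePoint ℂ) | O ∈ typeC n ∧ O ⊆ α} = ∅ :=
    (Set.ncard_eq_zero (hfin.finite_subsets.subset fun O hO => hO.2)).1 hk
  ext p
  induction p using OnePoint.rec with
  | infty => rw [infty_mem_stdUnion, orbitV_subset_iff_infty hα]
  | coe z =>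
    rw [coe_mem_stdUnion hn]
    constructor
    · intro hz
      by_cases h0 : z = 0
      · exact .inl ⟨(orbitV_subset_iff_zero hα).2 (h0 ▸ hz), h0⟩
      by_cases h1 : z ^ n = 1
      · exact .inr (.inl ⟨(orbitA_subset_iff hn hα h1).2 hz, h1⟩)
      by_cases h2 : z ^ n = -1
      · exact .inr (.inr (.inl ⟨(orbitB_subset_iff hn hα h2).2 hz, h2⟩))
      have : orbitC n z ∈ {O : Set (OnePoint ℂ) | O ∈ typeC n ∧ O ⊆ α} :=
        ⟨(mem_typeC_iff hn).2 ⟨z, h0, h1, h2, rfl⟩, (orbitC_subset_iff hn hα h0).2 hz⟩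
      rw [hC] at this
      exact this.elim
    · rintro (h | h | h | h)
      · rw [h.2]
        exact (orbitV_subset_iff_zero hα).1 h.1
      · exact (orbitA_subset_iff hn hα h.2).1 h.1
      · exact (orbitB_subset_iff hn hα h.2).1 h.1
      · obtain ⟨l, hl, -⟩ := h
        simp at hl

lemma apply_zero_mem_orbitV_of_mem_stdDihedral {n : ℕ} (hn : n ≠ 0) {f : Equiv.Perm (OnePoint ℂ)}
    (hf : f ∈ stdDihedral n) : f ((0 : ℂ) : OnePoint ℂ) ∈ orbitV := by
  obtain ⟨u, -, rfl | rfl⟩ := (mem_stdDihedral_iff hn).1 hf <;> simp [coe_mem_orbitV]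

lemma scaleMap_mem_stdDihedral_iff {n : ℕ} (hn : n ≠ 0) {u : ℂˣ} :
    scaleMap u ∈ stdDihedral n ↔ u ^ n = 1 := by
  rw [mem_stdDihedral_iff hn]
  constructor
  · rintro ⟨v, hv, h | h⟩
    · rwa [scaleMap_injective h]
    · exact absurd h.symm (scaleMap_mul_inversionMap_ne v u)
  · exact fun h => ⟨u, h, .inl rfl⟩

/-- Two antipodal points, the four points of a harmonic quadruple, and the vertices of an octahedron
have more symmetries than the dihedral group. -/
lemma moebiusStabilizer_ne_of_harmonic {n : ℕ} {α : Set (OnePoint ℂ)} (hfin : α.Finite) {PV : Prop}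
    {ω : ℂ} (hω : ω ≠ 0) (hi : ∞ ∈ α ↔ PV)
    (hz : ∀ z : ℂ, (z : OnePoint ℂ) ∈ α ↔ (PV ∧ z = 0) ∨ z ^ n = ω ^ n)
    (hn : n = 2 ∨ PV ∧ n = 4) : moebiusStabilizer α ≠ stdDihedral n := by
  intro h
  have hn0 : n ≠ 0 := by lia
  by_cases hPV : PV
  · have heven : Even n := by
      rcases hn with rfl | ⟨-, rfl⟩
      · exact even_two
      · exact ⟨2, rfl⟩
    -- A quarter turn: it cycles `∞ → ω → 0 → -ω → ∞` and fixes the two points with `z² = -ω²`,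
    -- which belong to the set when `n = 4`.
    have hdet : ω * ω - (-ω ^ 2) * 1 ≠ 0 := by
      rw [show ω * ω - (-ω ^ 2) * 1 = 2 * ω ^ 2 by ring]
      exact mul_ne_zero two_ne_zero (pow_ne_zero 2 hω)
    have hf : moebiusMap ω (-ω ^ 2) 1 ω hdet ∈ moebiusStabilizer α := by
      refine mem_moebiusStabilizer_of_finite hfin (moebiusMap_mem _) fun p hp => ?_
      induction p using OnePoint.rec with
      | infty =>
        rw [moebiusMap_infty, if_neg one_ne_zero, div_one, hz]
        exact .inr rfl
      | coe z =>
        by_cases h1 : z = -ω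
        · rw [moebiusMap_coe, if_pos (by rw [h1]; ring), hi]
          exact hPV
        have h1' : 1 * z + ω ≠ 0 := fun h => h1 (by linear_combination h)
        rw [moebiusMap_coe, if_neg h1', hz]
        rcases (hz z).1 hp with ⟨-, rfl⟩ | hp
        · right
          rw [show (ω * 0 + -ω ^ 2) / (1 * 0 + ω) = -ω by
            rw [div_eq_iff h1']
            ring, heven.neg_pow]
        by_cases h2 : z = ω
        · left
          refine ⟨hPV, ?_⟩
          rw [h2, show ω * ω + -ω ^ 2 = 0 by ring, zero_div]
        have h3 : (z ^ 2) ≠ ω ^ 2 := by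
          intro h
          rcases sq_eq_sq_iff_eq_or_eq_neg.1 h with h | h
          · exact h2 h
          · exact h1 h
        rcases hn with rfl | ⟨-, rfl⟩
        · exact absurd hp h3
        · right
          have h4 : z ^ 2 + ω ^ 2 = 0 := by
            apply mul_left_cancel₀ (sub_ne_zero.2 h3)
            linear_combination hp
          rw [show (ω * z + -ω ^ 2) / (1 * z + ω) = z by
            rw [div_eq_iff h1']
            linear_combination -h4, hp]
    rw [h] at hf
    have := apply_zero_mem_orbitV_of_mem_stdDihedral hn0 hf
    rw [moebiusMap_coe, if_neg (by simpa using hω), coe_mem_orbitV] at this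
    simp [hω] at this
  · obtain rfl : n = 2 := hn.resolve_right fun h => hPV h.1
    -- This map fixes `ω` and `-ω` but sends `0` to `ω / 2`.
    have hdet : 2 * ω * (2 * ω) - ω ^ 2 * 1 ≠ 0 := by
      rw [show 2 * ω * (2 * ω) - ω ^ 2 * 1 = 3 * ω ^ 2 by ring]
      exact mul_ne_zero three_ne_zero (pow_ne_zero 2 hω)
    have hf : moebiusMap (2 * ω) (ω ^ 2) 1 (2 * ω) hdet ∈ moebiusStabilizer α := by
      refine mem_moebiusStabilizer_of_finite hfin (moebiusMap_mem _) fun p hp => ?_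
      induction p using OnePoint.rec with
      | infty => exact absurd (hi.1 hp) hPV
      | coe z =>
        have h1 : z ^ 2 = ω ^ 2 := ((hz z).1 hp).resolve_left fun h => hPV h.1
        rwa [(moebiusMap_coe_eq_coe_iff hdet (w := z)).2 ⟨fun h => hω ?_, by linear_combination -h1⟩]
        have : 3 * ω ^ 2 = 0 := by linear_combination (2 * ω - z) * h + h1
        simpa using this
    rw [h] at hf
    have := apply_zero_mem_orbitV_of_mem_stdDihedral hn0 hf
    rw [moebiusMap_coe, if_neg (by simpa using hω), coe_mem_orbitV] at this
    simp [hω] at this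

/-- The sets without orbits of generic type whose stabilizer is the dihedral group. -/
lemma special_conditions {n : ℕ} (hn : 2 ≤ n) {PV PA PB : Prop}
    (h : moebiusStabilizer (stdUnion n PV PA PB 0) = stdDihedral n) :
    ((PA ∧ ¬ PB) ∨ (¬ PA ∧ PB)) ∧ n ≠ 2 ∧ (PV → n ≠ 4) := by
  have hn0 : n ≠ 0 := by lia
  have hmem {z : ℂ} : (z : OnePoint ℂ) ∈ stdUnion n PV PA PB 0 ↔
      (PV ∧ z = 0) ∨ (PA ∧ z ^ n = 1) ∨ (PB ∧ z ^ n = -1) := by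
    rw [coe_mem_stdUnion hn0]
    simp [explicitPowers]
  have hfin := finite_stdUnion (PV := PV) (PA := PA) (PB := PB) (k := 0) hn0
  have hscale {u : ℂˣ} (hu : ∀ z : ℂ, (PA ∧ z ^ n = 1) ∨ (PB ∧ z ^ n = -1) →
      (PA ∧ (u * z) ^ n = 1) ∨ (PB ∧ (u * z) ^ n = -1)) : u ^ n = 1 := by
    rw [← scaleMap_mem_stdDihedral_iff hn0, ← h]
    refine mem_moebiusStabilizer_of_finite hfin (scaleMap_mem u) fun p hp => ?_
    induction p using OnePoint.rec with
    | infty => rwa [scaleMap_infty]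
    | coe z =>
      rw [scaleMap_coe, hmem]
      rcases hmem.1 hp with h | h
      · exact .inl ⟨h.1, by rw [h.2, mul_zero]⟩
      · exact .inr (hu z h)
  have hPAB : (PA ∧ ¬ PB) ∨ (¬ PA ∧ PB) := by
    by_contra hcon
    by_cases hA : PA
    · have hB : PB := by tauto
      -- With both `A_n` and `B_n` present, the rotation by half the angle exchanges them.
      have hu := hscale (u := circleUnit (1 / (2 * n))) (by
        intro z hz
        rw [mul_pow, coe_circleUnit, circlePoint_odd_pow hn0]
        rcases hz with ⟨-, hz⟩ | ⟨-, hz⟩ <;> rw [hz]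
        · exact .inr ⟨hB, by norm_num⟩
        · exact .inl ⟨hA, by norm_num⟩)
      have := congrArg Units.val hu
      rw [Units.val_pow_eq_pow_val, coe_circleUnit, circlePoint_odd_pow hn0, Units.val_one] at this
      norm_num at this
    · have hB : ¬ PB := by tauto
      -- With neither present, `α` lies in `{0, ∞}` and every scaling preserves it; doubling already
      -- has infinite order.
      have hu := hscale (u := Units.mk0 2 two_ne_zero) (by simp [hA, hB])
      have := congrArg (fun u : ℂˣ => ‖(u : ℂ)‖) hu
      simp only [Units.val_pow_eq_pow_val, Units.val_mk0, norm_pow, Units.val_one, norm_one] at this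
      rw [pow_eq_one_iff_of_nonneg (norm_nonneg _) hn0] at this
      norm_num at this
  refine ⟨hPAB, ?_⟩
  by_contra hcon
  have hn' : n = 2 ∨ PV ∧ n = 4 := by tauto
  rcases hPAB with ⟨hA, hB⟩ | ⟨hA, hB⟩
  · refine moebiusStabilizer_ne_of_harmonic hfin (ω := 1) one_ne_zero infty_mem_stdUnion
      (fun z => ?_) hn' h
    rw [hmem, one_pow]
    simp [hA, hB]
  · refine moebiusStabilizer_ne_of_harmonic hfin (ω := circlePoint (1 / (2 * n)))
      (circlePoint_ne_zero _) infty_mem_stdUnion (fun z => ?_) hn' h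
    rw [hmem, circlePoint_odd_pow hn0]
    simp [hA, hB]

lemma index_conditions {n : ℕ} (hn : 2 ≤ n) {α : Set (OnePoint ℂ)} (hfin : α.Finite)
    (h : moebiusStabilizer α = stdDihedral n) :
    1 ≤ (dihedralIndex n α).2.2 ∨ ((dihedralIndex n α).2.2 = 0 ∧ (dihedralIndex n α).2.1 = 1 ∧ n ≠ 2 ∧
      ((dihedralIndex n α).1 = 1 → n ≠ 4)) := by
  classical
  have hn0 : n ≠ 0 := by lia
  rcases Nat.eq_zero_or_pos (dihedralIndex n α).2.2 with hk | hk
  · right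
    have hU := eq_stdUnion_of_index_zero hn0 hfin h.ge hk
    obtain ⟨hAB, h2, h4⟩ := special_conditions hn (hU ▸ h)
    refine ⟨hk, ?_, h2, fun hV => h4 ?_⟩
    · rw [dihedralIndex_snd_fst hn0]
      rcases hAB with ⟨h1, h2⟩ | ⟨h1, h2⟩ <;> simp [h1, h2]
    · rw [dihedralIndex_fst] at hV
      by_contra hcon
      simp [hcon] at hV
  · exact .inl hk

/-! ### Realizing the indices and the cardinalities -/

/-- For `n = 2` the inequality `3 + 2 v ≤ 2 (e + 2 k)` can fail when `V` is used without an orbit on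
the circle, whence `v ≤ e`. This loses no Klein index, which only counts special orbits. -/
lemma exists_of_index {n : ℕ} (hn : 2 ≤ n) {v e k : ℕ} (hv : v ≤ 1) (he : e ≤ 2) (hve : n = 2 → v ≤ e)
    (h : 1 ≤ k ∨ (k = 0 ∧ e = 1 ∧ n ≠ 2 ∧ (v = 1 → n ≠ 4))) :
    ∃ α : Set (OnePoint ℂ), α.Finite ∧ dihedralIndex n α = (v, e, k) ∧
      moebiusStabilizer α = stdDihedral n := by
  have hn0 : n ≠ 0 := by lia
  -- Here three points on the circle face two off it, too few for the rigidity argument.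
  by_cases hspecial : n = 3 ∧ v = 1 ∧ e = 1 ∧ k = 0
  · obtain ⟨rfl, rfl, rfl, rfl⟩ := hspecial
    exact ⟨_, finite_stdUnion hn0, by simp [dihedralIndex_stdUnion hn0], moebiusStabilizer_bipyramid⟩
  have hv' : (if v = 1 then 1 else 0) = v := by interval_cases v <;> rfl
  have he' : (if 1 ≤ e then 1 else 0) + (if e = 2 then 1 else 0) = e := by interval_cases e <;> rfl
  refine ⟨stdUnion n (v = 1) (1 ≤ e) (e = 2) k, finite_stdUnion hn0, ?_, ?_⟩
  · rw [dihedralIndex_stdUnion hn0, hv', he']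
  · refine moebiusStabilizer_stdUnion hn ?_ ?_
    · rcases h with h | h
      · exact .inl h
      · exact .inr ⟨h.1, by lia, by lia⟩
    · rw [hv', he']
      rcases h with h | ⟨rfl, rfl, h2, h4⟩
      · rcases hn.eq_or_lt with rfl | hn'
        · have := hve rfl
          lia
        · have : 3 * 2 ≤ n * (e + 2 * k) := Nat.mul_le_mul hn' (by lia)
          lia
      · have : v = 1 → n ≠ 3 := fun h1 h2 => hspecial ⟨h2, h1, rfl, rfl⟩
        lia

lemma nonempty_mulEquiv_of_eq {n : ℕ} (hn : n ≠ 0) {α : Set (OnePoint ℂ)}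
    (h : moebiusStabilizer α = stdDihedral n) :
    Nonempty (moebiusStabilizer α ≃* DihedralGroup n) := by
  rw [h]
  exact nonempty_stdDihedral_mulEquiv hn

lemma realizesDihedral_iff {n : ℕ} (hn : n ≠ 0) {idx : ℕ × ℕ × ℕ} {α : Set (OnePoint ℂ)} :
    RealizesDihedral n idx α ↔
      α.Finite ∧ dihedralIndex n α = idx ∧ moebiusStabilizer α = stdDihedral n := by
  rw [RealizesDihedral, isFiniteOrbitUnion_iff hn]
  constructor
  · rintro ⟨⟨h1, h2⟩, h3, h4⟩
    exact ⟨h1, h3, moebiusStabilizer_eq_of_mulEquiv hn h2 h4⟩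
  · rintro ⟨h1, h2, h3⟩
    exact ⟨⟨h1, h3.ge⟩, h2, nonempty_mulEquiv_of_eq hn h3⟩

lemma realizesKlein_iff {idx : ℕ × ℕ} {α : Set (OnePoint ℂ)} :
    RealizesKlein idx α ↔
      α.Finite ∧ kleinIndex α = idx ∧ moebiusStabilizer α = stdDihedral 2 := by
  rw [RealizesKlein, isKleinFour_iff_nonempty_mulEquiv, isFiniteOrbitUnion_iff two_ne_zero]
  constructor
  · rintro ⟨⟨h1, h2⟩, h3, h4⟩
    exact ⟨h1, h3, moebiusStabilizer_eq_of_mulEquiv two_ne_zero h2 h4⟩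
  · rintro ⟨h1, h2, h3⟩
    exact ⟨⟨h1, h3.ge⟩, h2, nonempty_mulEquiv_of_eq two_ne_zero h3⟩

/-- The cardinalities of the finite sets with dihedral stabilizer, in terms of component indices. -/
lemma exists_ncard_iff {n : ℕ} (hn : 2 ≤ n) (m : ℕ) :
    (∃ α : Set (OnePoint ℂ), α.Finite ∧ α.ncard = m ∧
      Nonempty (moebiusStabilizer α ≃* DihedralGroup n)) ↔
    ∃ α : Set (OnePoint ℂ), α.Finite ∧ moebiusStabilizer α = stdDihedral n ∧
      m = 2 * (dihedralIndex n α).1 + n * ((dihedralIndex n α).2.1 + 2 * (dihedralIndex n α).2.2) := by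
  have hn0 : n ≠ 0 := by lia
  constructor
  · rintro ⟨α, hfin, rfl, h⟩
    obtain ⟨g, h1, h2⟩ := exists_standard_position hn h
    refine ⟨g '' α, hfin.image g, moebiusStabilizer_eq_of_mulEquiv hn0 h1 h2, ?_⟩
    rw [← ncard_eq_of_invariant hn0 (hfin.image g) h1, Set.ncard_image_of_injective _ g.injective]
  · rintro ⟨α, hfin, h, rfl⟩
    exact ⟨α, hfin, ncard_eq_of_invariant hn0 hfin h.ge, nonempty_mulEquiv_of_eq hn0 h⟩

lemma explicitSet_eq_stdUnion (n k : ℕ) : explicitSet n k = stdUnion n False False False k := by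
  simp [stdUnion]

lemma moebiusStabilizer_explicitSet {n k : ℕ} (hn : 2 ≤ n) (hk : 1 ≤ k) :
    moebiusStabilizer (explicitSet n k) = stdDihedral n := by
  rw [explicitSet_eq_stdUnion]
  refine moebiusStabilizer_stdUnion hn (.inl hk) ?_
  have : 2 * 2 ≤ n * (2 * k) := Nat.mul_le_mul hn (by lia)
  simp only [if_false]
  lia

lemma dihedralIndex_explicitSet {n : ℕ} (hn : n ≠ 0) (k : ℕ) :
    dihedralIndex n (explicitSet n k) = (0, 0, k) := by
  rw [explicitSet_eq_stdUnion, dihedralIndex_stdUnion hn]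
  simp

lemma exists_realizesDihedral_iff {n : ℕ} (hn : 3 ≤ n) {ν ε k : ℕ} (hν : ν ≤ 1) (hε : ε ≤ 2) :
    (∃ α : Set (OnePoint ℂ), RealizesDihedral n (ν, ε, k) α) ↔
      (1 ≤ k ∨ (ν, ε, k) = (0, 1, 0) ∨ ((ν, ε, k) = (1, 1, 0) ∧ n ≠ 4)) := by
  have hn0 : n ≠ 0 := by lia
  simp only [realizesDihedral_iff hn0, Prod.mk.injEq]
  constructor
  · rintro ⟨α, hfin, hidx, h⟩
    have := index_conditions (by lia) hfin h
    rw [hidx] at this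
    simp only at this
    lia
  · intro h
    exact exists_of_index (by lia) hν hε (by lia) (by lia)

lemma exists_realizesKlein_iff {ν k : ℕ} (hν : ν ≤ 3) :
    (∃ α : Set (OnePoint ℂ), RealizesKlein (ν, k) α) ↔ 1 ≤ k := by
  simp only [realizesKlein_iff, kleinIndex_eq, Prod.mk.injEq]
  constructor
  · rintro ⟨α, hfin, hidx, h⟩
    have := index_conditions le_rfl hfin h
    lia
  · intro h
    -- Special orbits on the circle are used first; `V` enters only when all three are needed.
    obtain ⟨α, hfin, hidx, hα⟩ := exists_of_index (n := 2) le_rfl (v := if ν = 3 then 1 else 0)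
      (e := if ν = 3 then 2 else ν) (k := k) (by split_ifs <;> lia) (by split_ifs <;> lia)
      (by split_ifs <;> lia) (.inl h)
    refine ⟨α, hfin, ?_, hα⟩
    rw [hidx]
    simp only [and_true]
    split_ifs <;> lia

/-- The parameter `k` here stands for `ε + 2k` of the index. The value `1` arises only without
generic orbits, hence its extra conditions. -/
lemma setOf_ncard_dihedral {n : ℕ} (hn : 2 ≤ n) :
    {m : ℕ | ∃ α : Set (OnePoint ℂ), α.Finite ∧ α.ncard = m ∧
      Nonempty (moebiusStabilizer α ≃* DihedralGroup n)} =
    {m : ℕ | ∃ x k : ℕ, (x = 0 ∨ x = 2) ∧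
      (2 ≤ k ∨ k = 1 ∧ n ≠ 2 ∧ (x = 2 → n ≠ 4)) ∧ m = x + n * k} := by
  have hn0 : n ≠ 0 := by lia
  ext m
  rw [Set.mem_ofPred_eq, exists_ncard_iff hn, Set.mem_ofPred_eq]
  constructor
  · rintro ⟨α, hfin, h, rfl⟩
    have h1 := index_conditions hn hfin h
    have h2 := dihedralIndex_fst_le n α
    refine ⟨2 * (dihedralIndex n α).1, (dihedralIndex n α).2.1 + 2 * (dihedralIndex n α).2.2, ?_, ?_, rfl⟩
    · lia
    · lia
  · rintro ⟨x, k, hx, hk, rfl⟩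
    obtain ⟨v, e, j, hv, he, hve, hcond, hval⟩ : ∃ v e j : ℕ, v ≤ 1 ∧ e ≤ 2 ∧ (n = 2 → v ≤ e) ∧
        (1 ≤ j ∨ (j = 0 ∧ e = 1 ∧ n ≠ 2 ∧ (v = 1 → n ≠ 4))) ∧ x + n * k = 2 * v + n * (e + 2 * j) := by
      rcases hn.eq_or_lt with rfl | hn'
      -- For `n = 2` the summand `x = 2` has the size of one special orbit, so it is absorbed into
      -- the orbits on the circle and `V` is avoided.
      · refine ⟨0, (k + x / 2) % 2, (k + x / 2) / 2, by lia, by lia, by lia, by lia, by lia⟩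
      · have hk' : k % 2 + 2 * (k / 2) = k := Nat.mod_add_div k 2
        refine ⟨x / 2, k % 2, k / 2, by lia, by lia, by lia, by lia, ?_⟩
        rw [hk']
        lia
    obtain ⟨α, hfin, hidx, h⟩ := exists_of_index hn hv he hve hcond
    exact ⟨α, hfin, h, by rw [hidx, hval]⟩

theorem mainTheorem9 :
    -- the table for `n ≥ 3`: existence
    (∀ n : ℕ, 3 ≤ n → ∀ ν ε k : ℕ, ν ≤ 1 → ε ≤ 2 →
      ((∃ α : Set (OnePoint ℂ), RealizesDihedral n (ν, ε, k) α) ↔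
        (1 ≤ k ∨ (ν, ε, k) = (0, 1, 0) ∨ ((ν, ε, k) = (1, 1, 0) ∧ n ≠ 4)))) ∧
    -- the table for `n ≥ 3`: the stabilizer is the group itself, and the cardinalities
    (∀ n : ℕ, 3 ≤ n → ∀ (ν ε k : ℕ) (α : Set (OnePoint ℂ)), RealizesDihedral n (ν, ε, k) α →
      moebiusStabilizer α = stdDihedral n ∧ α.Finite ∧ α.ncard = 2 * ν + n * (ε + 2 * k)) ∧
    -- the table for `n = 2`: existence
    (∀ ν k : ℕ, ν ≤ 3 →
      ((∃ α : Set (OnePoint ℂ), RealizesKlein (ν, k) α) ↔ 1 ≤ k)) ∧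
    -- the table for `n = 2`: the stabilizer is the group itself, and the cardinalities
    (∀ (ν k : ℕ) (α : Set (OnePoint ℂ)), RealizesKlein (ν, k) α →
      moebiusStabilizer α = stdDihedral 2 ∧ α.Finite ∧ α.ncard = 2 * ν + 4 * k) ∧
    -- all cardinalities of finite sets with stabilizer isomorphic to `D_n`, `D_4`, `K_4`
    (∀ n : ℕ, 3 ≤ n → n ≠ 4 →
      {m : ℕ | ∃ α : Set (OnePoint ℂ), α.Finite ∧ α.ncard = m ∧
          Nonempty (moebiusStabilizer α ≃* DihedralGroup n)} =
        {m : ℕ | ∃ x k : ℕ, (x = 0 ∨ x = 2) ∧ 1 ≤ k ∧ m = x + n * k}) ∧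
    ({m : ℕ | ∃ α : Set (OnePoint ℂ), α.Finite ∧ α.ncard = m ∧
          Nonempty (moebiusStabilizer α ≃* DihedralGroup 4)} =
        {m : ℕ | ∃ x k : ℕ, (x = 0 ∨ x = 2) ∧ 2 ≤ k ∧ m = x + 4 * k} ∪ {4}) ∧
    ({m : ℕ | ∃ α : Set (OnePoint ℂ), α.Finite ∧ α.ncard = m ∧
          IsKleinFour (moebiusStabilizer α)} =
        {m : ℕ | ∃ k : ℕ, 2 ≤ k ∧ m = 2 * k}) ∧
    -- explicit sets realizing the indices `(0, 0, k)` and `(0, k)` for `k ≥ 1`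
    (∀ n k : ℕ, 3 ≤ n → 1 ≤ k → RealizesDihedral n (0, 0, k) (explicitSet n k)) ∧
    (∀ k : ℕ, 1 ≤ k → RealizesKlein (0, k) (explicitSet 2 k)) := by
  refine ⟨fun n hn ν ε k hν hε => exists_realizesDihedral_iff hn hν hε, fun n hn ν ε k α h => ?_,
    fun ν k hν => exists_realizesKlein_iff hν, fun ν k α h => ?_, fun n hn hn4 => ?_, ?_, ?_,
    fun n k hn hk => ?_, fun k hk => ?_⟩
  · have hn0 : n ≠ 0 := by lia
    obtain ⟨hfin, hidx, h⟩ := (realizesDihedral_iff hn0).1 h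
    refine ⟨h, hfin, ?_⟩
    rw [ncard_eq_of_invariant hn0 hfin h.ge, hidx]
  · obtain ⟨hfin, hidx, h⟩ := realizesKlein_iff.1 h
    refine ⟨h, hfin, ?_⟩
    rw [kleinIndex_eq, Prod.mk.injEq] at hidx
    rw [ncard_eq_of_invariant two_ne_zero hfin h.ge]
    lia
  · rw [setOf_ncard_dihedral (by lia)]
    ext m
    refine exists_congr fun x => exists_congr fun k => and_congr_right fun _ => and_congr_left fun _ => ?_
    lia
  · rw [setOf_ncard_dihedral (by lia)]
    ext m
    simp only [Set.mem_union, Set.mem_ofPred_eq, Set.mem_singleton_iff]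
    constructor
    · rintro ⟨x, k, hx, hk, rfl⟩
      by_cases hk2 : 2 ≤ k
      · exact .inl ⟨x, k, hx, hk2, rfl⟩
      · exact .inr (by lia)
    · rintro (⟨x, k, hx, hk, rfl⟩ | rfl)
      · exact ⟨x, k, hx, .inl hk, rfl⟩
      · exact ⟨0, 1, .inl rfl, by lia, rfl⟩
  · simp only [isKleinFour_iff_nonempty_mulEquiv]
    rw [setOf_ncard_dihedral le_rfl]
    ext m
    constructor
    · rintro ⟨x, k, hx, hk, rfl⟩
      exact ⟨k + x / 2, by lia, by lia⟩
    · rintro ⟨k, hk, rfl⟩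
      exact ⟨0, k, .inl rfl, .inl hk, by lia⟩
  · have hn0 : n ≠ 0 := by lia
    have h := moebiusStabilizer_explicitSet (n := n) (by lia) hk
    exact (realizesDihedral_iff hn0).2
      ⟨explicitSet_eq_stdUnion n k ▸ finite_stdUnion hn0, dihedralIndex_explicitSet hn0 k, h⟩
  · refine realizesKlein_iff.2 ⟨explicitSet_eq_stdUnion 2 k ▸ finite_stdUnion two_ne_zero, ?_,
      moebiusStabilizer_explicitSet le_rfl hk⟩
    rw [kleinIndex_eq, dihedralIndex_explicitSet two_ne_zero, zero_add]

end
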